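/- **Setting.** A *computable metric space* is a metric space $X$ with a dense sequence of points $\alpha(0),\alpha(1),\dots$ whose distances $d(\alpha(i),\alpha(j))$ are computable real numbers, uniformly in $i,j$. Its canonical basis consists of the open balls $B(\alpha(i),r)$ with rational $r$. Let $\mathcal M(X)$ be the set of Borel probability measures on $X$. Its canonical basis consists of the finite intersections of sets $\{\mu:\int f\,d\mu<r\}$ and $\{\mu:\int f\,d\mu>r\}$, where $r$ is rational and $f$ is a maximum of finitely many hat functions $x\mapsto |1-n\,|d(x,\alpha(i))-r'|^+|^+$ with $r'$ rational and $n\ge 1$ an integer. Products of such spaces carry the product bases. A function $f:Z\to[0,\infty]$ on such a space is *lower semicomputable* if, uniformly in the rational number $q\ge 0$, the set $\{z: f(z)>q\}$ is the union of a recursively enumerable family of canonical basis elements; a sequence $(f_e)$ is *uniformly lower semicomputable* if this holds uniformly in $e$ and $q$. A *Gödel enumeration* of the lower semicomputable functions on $Z$ is a uniformly lower semicomputable sequence $(\phi_e)_{e\in\mathbb N}$ containing all lower semicomputable functions on $Z$ and such that for every uniformly lower semicomputable sequence $(\psi_i)$ there is a recursive function $r$ with $\psi_i=\phi_{r(i)}$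 for all $i$. **Theorem.** Let $X$ and $Y$ be computable metric spaces. 1. Gödel enumerations of the lower semicomputable functions $X\times Y\times\mathcal M(X)\to[0,\infty]$ exist. 2. Let $(\phi_e)$ be such an enumeration and let $s:Y\times\mathcal M(X)\to[0,\infty]$ be lower semicomputable. There is a recursive function $e\mapsto e'$ such that (a) for all $e,y,\mu$: $\int\phi_{e'}(x,y,\mu)\,\mu(dx)\le s(y,\mu)$; (b) for all $e,y,\mu$: if $\int\phi_e(x,y,\mu)\,\mu(dx)<s(y,\mu)$, then $\phi_{e'}(\cdot,y,\mu)=\phi_e(\cdot,y,\mu)$. 3. Let $s:Y\times\mathcal M(X)\to[0,\infty]$ be lower semicomputable and let $E$ be the set of lower semicomputable functions $\phi:X\times Y\times\mathcal M(X)\to[0,\infty]$ with $\int\phi(x,y,\mu)\,\mu(dx)\le s(y,\mu)$ for all $y,\mu$. There is $\psi\in E$ such that for every $\phi\in E$ there is a constant $c_\phi<\infty$ with $\phi(x,y,\mu)\le 2c_\phi\,\psi(x,y,\mu)$ for all $x,y,\mu$ with $s(y,\mu)>0$ (hence everywhere, if $s$ is everywhere positive). 4. There is a universal uniform test: a lower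 semicomputable function $(x,\mu)\mapsto \mathbf t_\mu(x)\in[0,\infty]$ on $X\times\mathcal M(X)$ with $\int\mathbf t_\mu\,d\mu\le1$ for all $\mu$, such that for every lower semicomputable $(x,\mu)\mapsto t_\mu(x)\in[0,\infty]$ with $\int t_\mu\,d\mu\le1$ for all $\mu$ there is a constant $c>0$ with $t_\mu(x)\le c\,\mathbf t_\mu(x)$ for all $x,\mu$. -/

import Mathlib

open MeasureTheory
open scoped ENNReal NNReal

noncomputable section

namespace AlgRandom

/-! ### Codes of rational numbers -/

/-- The code `(a, b, c)` stands for the rational number `(a - b) / (c + 1)`. -/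
abbrev RatCode : Type := ℕ × ℕ × ℕ

/-- The rational number with a given code. -/
def RatCode.val (q : RatCode) : ℚ := ((q.1 : ℚ) - (q.2.1 : ℚ)) / ((q.2.2 : ℚ) + 1)

/-- The code `(a, b)` stands for the nonnegative rational number `a / (b + 1)`. -/
abbrev LevelCode : Type := ℕ × ℕ

/-- The nonnegative rational number with a given code, as an element of `[0, ∞]`. -/
def LevelCode.val (q : LevelCode) : ℝ≥0∞ := (q.1 : ℝ≥0∞) / ((q.2 : ℝ≥0∞) + 1)

/-! ### Computable metric spaces -/

/-- A computable metric space: a metric space with an enumerated dense sequence of points whose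
mutual distances are computable real numbers, that is, both upper and lower semicomputable
(the rational upper and lower bounds are recursively enumerable), uniformly in the two indices. -/
class ComputableMetricSpace (X : Type*) [MetricSpace X] where
  /-- The enumeration of the dense set. -/
  pt : ℕ → X
  dense_pt : DenseRange pt
  re_dist_lt : REPred fun p : (ℕ × ℕ) × RatCode =>
    dist (pt p.1.1) (pt p.1.2) < ((p.2.val : ℚ) : ℝ)
  re_lt_dist : REPred fun p : (ℕ × ℕ) × RatCode =>
    ((p.2.val : ℚ) : ℝ) < dist (pt p.1.1) (pt p.1.2)

/-! ### Enumerated bases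

An effective topological space is presented by an enumerated basis `β : I → Set Z`, where `I` is
a type of finite codes. -/

/-- The basis of a computable metric space: the open balls with centers in the dense sequence and
with rational radii (a ball of nonpositive radius is empty). -/
def ballBasis (X : Type*) [MetricSpace X] [ComputableMetricSpace X] :
    ℕ × RatCode → Set X :=
  fun p => Metric.ball (ComputableMetricSpace.pt p.1) ((p.2.val : ℚ) : ℝ)

/-- The product of two enumerated bases. -/
def prodBasis {Z W I J : Type*} (β : I → Set Z) (γ : J → Set W) : I × J → Set (Z × W) :=
  fun p => β p.1 ×ˢ γ p.2

/-- The hat function `|1 - |d(x, u) - r|⁺ / ε|⁺`, equal to `1` on the ball of radius `r` about `u`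
and to `0` outside the ball of radius `r + ε`. -/
def hat {X : Type*} [MetricSpace X] (u : X) (r ε : ℝ) (x : X) : ℝ :=
  max (1 - max (dist x u - r) 0 / ε) 0

/-- The maximum of finitely many hat functions `g_{u, r, 1/n}` with `u` in the dense sequence,
`r` rational and `n ≥ 1`. The entry `(i, r, k)` of the list stands for the hat function with
`u = pt i` and `n = k + 1`. Hat functions are nonnegative, so starting from `0` changes nothing;
the empty list gives the function `0`. -/
def hatMax {X : Type*} [MetricSpace X] [ComputableMetricSpace X] :
    List (ℕ × RatCode × ℕ) → X → ℝ
  | [], _ => 0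
  | (i, r, k) :: L, x =>
    max (hat (ComputableMetricSpace.pt i) ((r.val : ℚ) : ℝ) (1 / ((k : ℝ) + 1)) x) (hatMax L x)

/-- The subbasis of the space of probability measures: the sets `{μ : r < μ f}` (Boolean code
`true`) and `{μ : μ f < r}` (Boolean code `false`), where `f` is a maximum of finitely many hat
functions and `r` is rational. -/
def measSubbasis (X : Type*) [MetricSpace X] [ComputableMetricSpace X] [MeasurableSpace X] :
    List (ℕ × RatCode × ℕ) × RatCode × Bool → Set (ProbabilityMeasure X)
  | (L, r, true) => {μ | ((r.val : ℚ) : ℝ) < ∫ x, hatMax L x ∂(μ : Measure X)}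
  | (L, r, false) => {μ | ∫ x, hatMax L x ∂(μ : Measure X) < ((r.val : ℚ) : ℝ)}

/-- The basis of the space of probability measures: finite intersections of subbasis elements. -/
def measBasis (X : Type*) [MetricSpace X] [ComputableMetricSpace X] [MeasurableSpace X] :
    List (List (ℕ × RatCode × ℕ) × RatCode × Bool) → Set (ProbabilityMeasure X) :=
  fun l => {μ | ∀ k ∈ l, μ ∈ measSubbasis X k}

/-! ### Lower semicomputable functions -/

/-- `f : Z → [0, ∞]` is lower semicomputable: the sets `f⁻¹((q, ∞])` are unions of recursively
enumerable families of basis elements, uniformly in the rational number `q ≥ 0`. -/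
def LowerSemicomputable {Z I : Type*} [Primcodable I] (β : I → Set Z) (f : Z → ℝ≥0∞) : Prop :=
  ∃ A : I × LevelCode → Prop, REPred A ∧
    ∀ q : LevelCode, {z | q.val < f z} = ⋃ (i : I) (_ : A (i, q)), β i

/-- The functions `ψ 0, ψ 1, …` are lower semicomputable uniformly in the index. -/
def UniformlyLowerSemicomputable {Z I : Type*} [Primcodable I] (β : I → Set Z)
    (ψ : ℕ → Z → ℝ≥0∞) : Prop :=
  ∃ A : ℕ × I × LevelCode → Prop, REPred A ∧
    ∀ (e : ℕ) (q : LevelCode), {z | q.val < ψ e z} = ⋃ (i : I) (_ : A (e, i, q)), β i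

/-- `φ 0, φ 1, …` is an acceptable (Gödel) enumeration of all lower semicomputable functions: it is
effective, it exhausts the lower semicomputable functions, and an index in it can be computed from
an index in any other effective sequence of lower semicomputable functions. -/
structure IsGoedelEnumeration {Z I : Type*} [Primcodable I] (β : I → Set Z)
    (φ : ℕ → Z → ℝ≥0∞) : Prop where
  effective : UniformlyLowerSemicomputable β φ
  exhaustive : ∀ f : Z → ℝ≥0∞, LowerSemicomputable β f → ∃ e, φ e = f
  translation : ∀ ψ : ℕ → Z → ℝ≥0∞, UniformlyLowerSemicomputable β ψ →
    ∃ r : ℕ → ℕ, Computable r ∧ ∀ i, φ (r i) = ψ i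

/-! ### Functions of points, parameters and measures; tests -/

section Tests

variable (X Y : Type*) [MetricSpace X] [ComputableMetricSpace X] [MeasurableSpace X]
  [MetricSpace Y] [ComputableMetricSpace Y]

/-- The basis of `X × 𝓜(X)`. -/
def pointMeasBasis := prodBasis (ballBasis X) (measBasis X)

/-- The basis of `Y × 𝓜(X)`. -/
def paramMeasBasis := prodBasis (ballBasis Y) (measBasis X)

/-- The basis of `X × Y × 𝓜(X)`. -/
def pointParamMeasBasis := prodBasis (ballBasis X) (prodBasis (ballBasis Y) (measBasis X))

variable {X Y}

/-- The set of lower semicomputable functions `φ(x, y, μ) ≥ 0` with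
`∫ φ(x, y, μ) μ(dx) ≤ s(y, μ)` for all `y` and `μ`. -/
def boundedFunctions (s : Y × ProbabilityMeasure X → ℝ≥0∞) :
    Set (X × Y × ProbabilityMeasure X → ℝ≥0∞) :=
  {φ | LowerSemicomputable (pointParamMeasBasis X Y) φ ∧
    ∀ (y : Y) (μ : ProbabilityMeasure X), ∫⁻ x, φ (x, y, μ) ∂(μ : Measure X) ≤ s (y, μ)}

/-- A uniform test of randomness. -/
def IsUniformTest (t : X × ProbabilityMeasure X → ℝ≥0∞) : Prop :=
  LowerSemicomputable (pointMeasBasis X) t ∧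
    ∀ μ : ProbabilityMeasure X, ∫⁻ x, t (x, μ) ∂(μ : Measure X) ≤ 1

/-- A uniform test is universal if it dominates every uniform test up to a constant factor. -/
def IsUniversalUniformTest (u : X × ProbabilityMeasure X → ℝ≥0∞) : Prop :=
  IsUniformTest u ∧ ∀ t : X × ProbabilityMeasure X → ℝ≥0∞, IsUniformTest t →
    ∃ c : ℝ≥0, 0 < c ∧ ∀ (x : X) (μ : ProbabilityMeasure X), t (x, μ) ≤ c * u (x, μ)

end Tests

end AlgRandom

end

/-!
Everything reduces to one effective operation, *trimming*: from a uniformly lower semicomputable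
sequence `φ e` on `X × P`, where `P` is a space of parameters `p` each carrying a probability
measure `m p` on `X`, and from a lower semicomputable bound `s` on `P`, one obtains a uniformly
lower semicomputable sequence `ψ e` with integrals at most `s` that agrees with `φ e` at all
parameters where the integral of `φ e` is below `s`. Both `P = Y × 𝓜(X)` and `P = 𝓜(X)` occur, the
first for the statements with parameters, the second for uniform tests.

A basis element `β i` of `X × P` is exhausted by smaller basis elements, each separated from the
complement of `β i` by a closed set whose complement is recursively enumerable open (balls have
slightly smaller closed balls inside them, and strict inequalities for measures have slightly
stricter weak ones): `EffectivelyRegular`. Hence `φ e` is the supremum of an increasing sequence of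
step functions over basis elements, and the corresponding step functions over the separating closed
sets are still below `φ e` (`UniformlyLowerSemicomputable.exists_steps`). A stage is accepted at `p`
when the integral of its step function over the closed sets is below `s p`, and `ψ e` is the
supremum of the accepted stages (`UniformlyLowerSemicomputable.exists_trim`).

Trimming is effective because acceptance is a recursively enumerable open condition on `p`
(`REOpenFamily.lintegral_stepSup_lt`). The measure of a section of a recursively enumerable open
set is lower semicomputable in `p`, since it is the supremum of the integrals of maxima of hat
functions supported in finite unions of balls (`REOpenFamily.lt_measureReal_section`). As the total
mass is `1`, the measure of the set where a step function over closed sets exceeds a level is upper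
semicomputable, and finitely many such levels bound the integral from above as closely as desired
(`lintegral_le_of_layers`, `exists_layers`).

Acceptable enumerations exist over every basis, by the universal machine and the s-m-n theorem
(`isGoedelEnumeration_universalSeq`). Trimming such an enumeration and taking the supremum of
`ψ e / 2 ^ (e + 1)` gives the optimal function (`exists_optimal`): the half of a competitor `f` is
some `φ e`, and it is left intact wherever `s` is positive, since its integral is below `s` there or
`s` is infinite. The universal uniform test is the case `s = 1`.
-/

noncomputable section

namespace AlgRandom

open Filter Topology

/-! ### Primitive recursive functions and recursively enumerable predicates -/

-- `fun_prop` proves that the reindexing functions between types of codes are primitive recursive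

attribute [fun_prop] Primrec
attribute [fun_prop] Primrec.id Primrec.const Primrec.comp Primrec.pair Primrec.fst Primrec.snd

section Computability

variable {α β γ : Type*} [Primcodable α] [Primcodable β] [Primcodable γ]

@[fun_prop]
theorem primrec_fst {f : α → β × γ} (h : Primrec f) : Primrec fun a => (f a).1 :=
  Primrec.fst.comp h

@[fun_prop]
theorem primrec_snd {f : α → β × γ} (h : Primrec f) : Primrec fun a => (f a).2 :=
  Primrec.snd.comp h

@[fun_prop]
theorem primrec_add {f g : α → ℕ} (hf : Primrec f) (hg : Primrec g) :
    Primrec fun a => f a + g a :=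
  Primrec.nat_add.comp hf hg

@[fun_prop]
theorem primrec_mul {f g : α → ℕ} (hf : Primrec f) (hg : Primrec g) :
    Primrec fun a => f a * g a :=
  Primrec.nat_mul.comp hf hg

@[fun_prop]
theorem primrec_pow {f g : α → ℕ} (hf : Primrec f) (hg : Primrec g) :
    Primrec fun a => f a ^ g a :=
  Primrec₂.comp (Primrec₂.unpaired'.1 Nat.Primrec.pow) hf hg

@[fun_prop]
theorem primrec_not {f : α → Bool} (hf : Primrec f) : Primrec fun a => !(f a) :=
  Primrec.not.comp hf

@[fun_prop]
theorem primrec_map {f : α → List β} {g : α → β → γ} (hf : Primrec f)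
    (hg : Primrec fun p : α × β => g p.1 p.2) : Primrec fun a => (f a).map (g a) :=
  Primrec.list_map hf hg

@[fun_prop]
theorem primrec_filterMap {f : α → List β} {g : α → β → Option γ} (hf : Primrec f)
    (hg : Primrec fun p : α × β => g p.1 p.2) : Primrec fun a => (f a).filterMap (g a) :=
  Primrec.listFilterMap hf hg

@[fun_prop]
theorem primrec_cons {f : α → β} {g : α → List β} (hf : Primrec f) (hg : Primrec g) :
    Primrec fun a => f a :: g a :=
  Primrec.list_cons.comp hf hg

@[fun_prop]
theorem primrec_range {f : α → ℕ} (hf : Primrec f) : Primrec fun a => List.range (f a) :=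
  Primrec.list_range.comp hf

@[fun_prop]
theorem primrec_list_sum {f : α → List ℕ} (hf : Primrec f) : Primrec fun a => (f a).sum :=
  Primrec.list_foldr (h := fun _ p => p.1 + p.2) hf (Primrec.const 0)
    (by unfold Primrec₂; fun_prop)

theorem primrecPred_le {f g : α → ℕ} (hf : Primrec f) (hg : Primrec g) :
    PrimrecPred fun a => f a ≤ g a :=
  Primrec.nat_le.comp hf hg

theorem primrecPred_lt {f g : α → ℕ} (hf : Primrec f) (hg : Primrec g) :
    PrimrecPred fun a => f a < g a :=
  Primrec.nat_lt.comp hf hg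

theorem primrecPred_eq {f g : α → β} (hf : Primrec f) (hg : Primrec g) :
    PrimrecPred fun a => f a = g a :=
  Primrec.eq.comp hf hg

theorem primrecPred_mem {f : α → β} {g : α → List β} (hf : Primrec f) (hg : Primrec g) :
    PrimrecPred fun a => f a ∈ g a :=
  PrimrecPred.of_eq ((PrimrecRel.exists_mem_list (R := fun b c : β => b = c) Primrec.eq).comp hg hf)
    (by simp)

theorem _root_.REPred.comp {p : β → Prop} (hp : REPred p) {f : α → β} (hf : Primrec f) :
    REPred fun a => p (f a) :=
  Partrec.comp hp hf.to_comp

theorem _root_.PrimrecPred.to_re {p : α → Prop} (hp : PrimrecPred p) : REPred p := by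
  obtain ⟨_, h⟩ := hp
  exact ComputablePred.to_re ⟨inferInstance, h.to_comp⟩

/-- The normal form of a recursively enumerable predicate. The bound `k` is a number of steps of
computation, so the matrix is monotone in it. -/
theorem _root_.REPred.exists_primrecRel {p : α → Prop} (hp : REPred p) :
    ∃ R : α → ℕ → Prop, PrimrecRel R ∧ (∀ a k l, k ≤ l → R a k → R a l) ∧
      ∀ a, p a ↔ ∃ k, R a k := by
  obtain ⟨c, hc⟩ := Nat.Partrec.Code.exists_code.1 hp
  refine ⟨fun a k => (Nat.Partrec.Code.evaln k c (Encodable.encode a)).isSome = true, ?_, ?_, ?_⟩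
  · refine PrimrecPred.primrecRel (p := fun x : α × ℕ =>
      (Nat.Partrec.Code.evaln x.2 c (Encodable.encode x.1)).isSome = true) ?_
    refine primrecPred_eq (Primrec.option_isSome.comp ?_) (Primrec.const true)
    exact Nat.Partrec.Code.primrec_evaln.comp
      ((Primrec.snd.pair (Primrec.const c)).pair (Primrec.encode.comp Primrec.fst))
  · intro a k l hkl h
    obtain ⟨x, hx⟩ := Option.isSome_iff_exists.1 h
    exact Option.isSome_iff_exists.2 ⟨x, Nat.Partrec.Code.evaln_mono hkl hx⟩
  · intro a
    have h1 : p a ↔ (Nat.Partrec.Code.eval c (Encodable.encode a)).Dom := by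
      rw [hc]; simp [Part.assert]
    rw [h1, Part.dom_iff_mem]
    constructor
    · rintro ⟨x, hx⟩
      obtain ⟨k, hk⟩ := Nat.Partrec.Code.evaln_complete.1 hx
      exact ⟨k, Option.isSome_iff_exists.2 ⟨x, hk⟩⟩
    · rintro ⟨k, hk⟩
      obtain ⟨x, hx⟩ := Option.isSome_iff_exists.1 hk
      exact ⟨x, Nat.Partrec.Code.evaln_sound hx⟩

theorem rePred_exists_nat {R : α → ℕ → Prop} (hR : PrimrecRel R) : REPred fun a => ∃ k, R a k := by
  classical
  have h : Computable₂ fun a k => if R a k then some () else none :=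
    (Primrec.ite (c := fun x : α × ℕ => R x.1 x.2) hR (Primrec.const (some ()))
      (Primrec.const none)).to_comp
  refine (Partrec.rfindOpt h).dom_re.of_eq fun a => ?_
  rw [Nat.rfindOpt_dom]
  constructor
  · rintro ⟨k, x, hx⟩
    by_cases hk : R a k
    · exact ⟨k, hk⟩
    · simp [hk] at hx
  · rintro ⟨k, hk⟩
    exact ⟨k, (), by simp [hk]⟩

theorem _root_.REPred.and {p q : α → Prop} (hp : REPred p) (hq : REPred q) :
    REPred fun a => p a ∧ q a := by
  obtain ⟨R, hR, mR, eR⟩ := hp.exists_primrecRel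
  obtain ⟨S, hS, mS, eS⟩ := hq.exists_primrecRel
  refine (rePred_exists_nat (R := fun a k => R a k ∧ S a k) (PrimrecPred.and hR hS)).of_eq
    fun a => ?_
  rw [eR, eS]
  constructor
  · rintro ⟨k, h, h'⟩; exact ⟨⟨k, h⟩, k, h'⟩
  · rintro ⟨⟨k, h⟩, l, h'⟩
    exact ⟨max k l, mR _ _ _ (le_max_left _ _) h, mS _ _ _ (le_max_right _ _) h'⟩

theorem _root_.REPred.or {p q : α → Prop} (hp : REPred p) (hq : REPred q) :
    REPred fun a => p a ∨ q a := by
  obtain ⟨R, hR, mR, eR⟩ := hp.exists_primrecRel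
  obtain ⟨S, hS, mS, eS⟩ := hq.exists_primrecRel
  refine (rePred_exists_nat (R := fun a k => R a k ∨ S a k) (PrimrecPred.or hR hS)).of_eq
    fun a => ?_
  rw [eR, eS, exists_or]

theorem _root_.REPred.exists {p : α × β → Prop} (hp : REPred p) : REPred fun a => ∃ b, p (a, b) := by
  classical
  obtain ⟨R, hR, mR, eR⟩ := hp.exists_primrecRel
  -- one number codes both the witness and the number of steps
  let S : α → ℕ → Prop := fun a k =>
    ((Encodable.decode (α := β) k.unpair.1).bind fun b =>
      if R (a, b) k.unpair.2 then some () else none).isSome = true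
  have hS : PrimrecRel S := by
    refine PrimrecPred.primrecRel (p := fun x : α × ℕ => S x.1 x.2) ?_
    refine primrecPred_eq (Primrec.option_isSome.comp (Primrec.option_bind
      (Primrec.decode.comp (Primrec.fst.comp (Primrec.unpair.comp Primrec.snd))) ?_))
      (Primrec.const true)
    refine Primrec.ite (c := fun x : (α × ℕ) × β => R (x.1.1, x.2) x.1.2.unpair.2) ?_
      (Primrec.const _) (Primrec.const _)
    exact hR.comp ((Primrec.fst.comp Primrec.fst).pair Primrec.snd)
      (Primrec.snd.comp (Primrec.unpair.comp (Primrec.snd.comp Primrec.fst)))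
  refine (rePred_exists_nat hS).of_eq fun a => ?_
  constructor
  · rintro ⟨k, hk⟩
    simp only [S] at hk
    rcases h : (Encodable.decode (α := β) k.unpair.1) with _ | b
    · simp [h] at hk
    · rw [h] at hk
      by_cases h2 : R (a, b) k.unpair.2
      · exact ⟨b, (eR _).2 ⟨_, h2⟩⟩
      · simp [h2] at hk
  · rintro ⟨b, hb⟩
    obtain ⟨k, hk⟩ := (eR _).1 hb
    exact ⟨Nat.pair (Encodable.encode b) k, by simp [S, hk]⟩

theorem _root_.REPred.forall_mem {p : α × β → Prop} (hp : REPred p) :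
    REPred fun x : α × List β => ∀ b ∈ x.2, p (x.1, b) := by
  obtain ⟨R, hR, mR, eR⟩ := hp.exists_primrecRel
  have h : PrimrecRel fun (l : List β) (y : α × ℕ) => ∀ b ∈ l, R (y.1, b) y.2 := by
    refine PrimrecRel.forall_mem_list (R := fun (b : β) (y : α × ℕ) => R (y.1, b) y.2) ?_
    refine PrimrecPred.primrecRel (p := fun x : β × α × ℕ => R (x.2.1, x.1) x.2.2) ?_
    exact hR.comp ((Primrec.fst.comp Primrec.snd).pair Primrec.fst) (Primrec.snd.comp Primrec.snd)
  have h' : PrimrecRel fun (x : α × List β) (k : ℕ) => ∀ b ∈ x.2, R (x.1, b) k :=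
    PrimrecPred.primrecRel (h.comp (f := fun x : (α × List β) × ℕ => x.1.2)
      (g := fun x : (α × List β) × ℕ => (x.1.1, x.2)) (by fun_prop) (by fun_prop))
  refine (rePred_exists_nat h').of_eq fun ⟨a, l⟩ => ?_
  simp only
  induction l with
  | nil => simp
  | cons b l ih =>
    rw [List.forall_mem_cons, ← ih, eR]
    simp only [List.forall_mem_cons]
    constructor
    · rintro ⟨k, h, h'⟩; exact ⟨⟨k, h⟩, k, h'⟩
    · rintro ⟨⟨k, h⟩, m, h'⟩
      exact ⟨max k m, mR _ _ _ (le_max_left _ _) h,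
        fun c hc => mR _ _ _ (le_max_right _ _) (h' c hc)⟩

end Computability

/-! ### Recursively enumerable families of open sets -/

section Families

variable {α κ I Z : Type*} [Primcodable α] [Primcodable κ] [Primcodable I] {β : I → Set Z}

/-- The sets `U a` are unions of recursively enumerable families of basis elements, uniformly in
the code `a`. -/
def REOpenFamily (β : I → Set Z) (U : α → Set Z) : Prop :=
  ∃ A : α × I → Prop, REPred A ∧ ∀ a z, z ∈ U a ↔ ∃ i, A (a, i) ∧ z ∈ β i

/-- Finite intersections of basis elements are recursively enumerable open sets, uniformly in the
list of their codes. The empty list makes the whole space such a set. -/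
def HasEffectiveInter (β : I → Set Z) : Prop :=
  REOpenFamily β fun l : List I => {z | ∀ i ∈ l, z ∈ β i}

namespace REOpenFamily

theorem of_eq {U V : α → Set Z} (h : REOpenFamily β U) (e : ∀ a z, z ∈ U a ↔ z ∈ V a) :
    REOpenFamily β V := by
  obtain ⟨A, hA, hU⟩ := h
  exact ⟨A, hA, fun a z => by rw [← e, hU]⟩

theorem basis : REOpenFamily β β :=
  ⟨fun x => x.1 = x.2, (primrecPred_eq Primrec.fst Primrec.snd).to_re, fun a z => by simp⟩

theorem comp {U : α → Set Z} (h : REOpenFamily β U) {f : κ → α} (hf : Primrec f) :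
    REOpenFamily β fun k => U (f k) := by
  obtain ⟨A, hA, hU⟩ := h
  exact ⟨fun x => A (f x.1, x.2), hA.comp (by fun_prop), fun a z => hU _ _⟩

/-- The restriction of a family to the codes with a recursively enumerable property. -/
theorem guard {U : α → Set Z} (h : REOpenFamily β U) {p : α → Prop} (hp : REPred p) :
    REOpenFamily β fun a => {z | p a ∧ z ∈ U a} := by
  obtain ⟨A, hA, hU⟩ := h
  refine ⟨fun x => p x.1 ∧ A x, (hp.comp Primrec.fst).and hA, fun a z => ?_⟩
  simp only [Set.mem_ofPred_eq, hU]
  grind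

theorem iUnion {U : α × κ → Set Z} (h : REOpenFamily β U) :
    REOpenFamily β fun a => {z | ∃ k, z ∈ U (a, k)} := by
  obtain ⟨A, hA, hU⟩ := h
  refine ⟨fun x => ∃ k, A ((x.1, k), x.2), ?_, fun a z => ?_⟩
  · exact REPred.exists (p := fun y : (α × I) × κ => A ((y.1.1, y.2), y.1.2))
      (hA.comp (by fun_prop))
  · simp only [Set.mem_ofPred_eq, hU]
    grind

theorem union {U V : α → Set Z} (hU : REOpenFamily β U) (hV : REOpenFamily β V) :
    REOpenFamily β fun a => {z | z ∈ U a ∨ z ∈ V a} := by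
  obtain ⟨A, hA, hU⟩ := hU
  obtain ⟨B, hB, hV⟩ := hV
  refine ⟨fun x => A x ∨ B x, hA.or hB, fun a z => ?_⟩
  simp only [Set.mem_ofPred_eq, hU, hV]
  grind

/-- Finite intersections of members of a family, with the list of the members as a parameter. -/
theorem forall_mem (hβ : HasEffectiveInter β) {U : α × κ → Set Z} (h : REOpenFamily β U) :
    REOpenFamily β fun x : α × List κ => {z | ∀ k ∈ x.2, z ∈ U (x.1, k)} := by
  obtain ⟨A, hA, hU⟩ := h
  obtain ⟨B, hB, hI⟩ := hβ
  -- the list `W` chooses a basis element inside each of the sets to be intersected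
  refine ⟨fun y => ∃ W : List (κ × I), W.map Prod.fst = y.1.2 ∧
    (∀ w ∈ W, A ((y.1.1, w.1), w.2)) ∧ B (W.map Prod.snd, y.2), ?_, ?_⟩
  · refine REPred.exists (p := fun v : ((α × List κ) × I) × List (κ × I) =>
      v.2.map Prod.fst = v.1.1.2 ∧ (∀ w ∈ v.2, A ((v.1.1.1, w.1), w.2)) ∧
        B (v.2.map Prod.snd, v.1.2)) ?_
    refine (primrecPred_eq (by fun_prop) (by fun_prop)).to_re.and (REPred.and ?_ ?_)
    · have h1 := REPred.forall_mem (p := fun u : α × κ × I => A ((u.1, u.2.1), u.2.2))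
        (hA.comp (by fun_prop))
      exact h1.comp (f := fun v : ((α × List κ) × I) × List (κ × I) => (v.1.1.1, v.2))
        (by fun_prop)
    · exact hB.comp (f := fun v : ((α × List κ) × I) × List (κ × I) => (v.2.map Prod.snd, v.1.2))
        (by fun_prop)
  · rintro ⟨a, l⟩ z
    simp only [Set.mem_ofPred_eq]
    constructor
    · intro hz
      choose g hg using fun k hk => (hU (a, k) z).1 (hz k hk)
      let W := l.attach.map fun k => (k.1, g k.1 k.2)
      have hW : ∀ w ∈ W, A ((a, w.1), w.2) ∧ z ∈ β w.2 := by
        simp only [W, List.mem_map]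
        rintro _ ⟨k, _, rfl⟩
        exact hg k.1 k.2
      have h2 := (hI (W.map Prod.snd) z).1 (by
        simp only [Set.mem_ofPred_eq, List.mem_map]
        rintro _ ⟨w, hw, rfl⟩
        exact (hW w hw).2)
      obtain ⟨i, hi, hzi⟩ := h2
      exact ⟨i, ⟨W, by simp [W, Function.comp_def], fun w hw => (hW w hw).1, hi⟩, hzi⟩
    · rintro ⟨i, ⟨W, rfl, hW, hi⟩, hzi⟩ k hk
      obtain ⟨w, hw, rfl⟩ := List.mem_map.1 hk
      have := (hI (W.map Prod.snd) z).2 ⟨i, hi, hzi⟩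
      exact (hU _ _).2 ⟨w.2, hW w hw, this _ (List.mem_map_of_mem hw)⟩

theorem univ (hβ : HasEffectiveInter β) : REOpenFamily β fun _ : α => (Set.univ : Set Z) :=
  (hβ.comp (f := fun _ : α => ([] : List I)) (by fun_prop)).of_eq (by simp)

theorem inter (hβ : HasEffectiveInter β) {U V : α → Set Z} (hU : REOpenFamily β U)
    (hV : REOpenFamily β V) : REOpenFamily β fun a => {z | z ∈ U a ∧ z ∈ V a} := by
  obtain ⟨A, hA, hU⟩ := hU
  obtain ⟨B, hB, hV⟩ := hV
  obtain ⟨C, hC, hI⟩ := hβ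
  refine ⟨fun x => ∃ v : I × I, A (x.1, v.1) ∧ B (x.1, v.2) ∧ C ([v.1, v.2], x.2), ?_, ?_⟩
  · refine REPred.exists (p := fun y : (α × I) × I × I =>
      A (y.1.1, y.2.1) ∧ B (y.1.1, y.2.2) ∧ C ([y.2.1, y.2.2], y.1.2)) ?_
    exact (hA.comp (f := fun y : (α × I) × I × I => (y.1.1, y.2.1)) (by fun_prop)).and
      ((hB.comp (f := fun y : (α × I) × I × I => (y.1.1, y.2.2)) (by fun_prop)).and
        (hC.comp (f := fun y : (α × I) × I × I => ([y.2.1, y.2.2], y.1.2)) (by fun_prop)))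
  · intro a z
    have h2 := fun i j => hI [i, j] z
    simp only [Set.mem_ofPred_eq, hU, hV]
    simp only [List.mem_cons, List.not_mem_nil, or_false, forall_eq_or_imp, forall_eq,
      Set.mem_ofPred_eq] at h2
    constructor
    · rintro ⟨⟨i, hi, hz⟩, j, hj, hz'⟩
      obtain ⟨k, hk, hzk⟩ := (h2 i j).1 ⟨hz, hz'⟩
      exact ⟨k, ⟨(i, j), hi, hj, hk⟩, hzk⟩
    · rintro ⟨k, ⟨⟨i, j⟩, hi, hj, hk⟩, hzk⟩
      obtain ⟨hz, hz'⟩ := (h2 i j).2 ⟨k, hk, hzk⟩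
      exact ⟨⟨i, hi, hz⟩, j, hj, hz'⟩

end REOpenFamily

end Families

/-! ### Levels -/

theorem LevelCode.val_eq_coe (q : LevelCode) :
    q.val = (((q.1 : ℝ≥0) / ((q.2 : ℝ≥0) + 1) : ℝ≥0) : ℝ≥0∞) := by
  rw [ENNReal.coe_div (by positivity)]
  simp [LevelCode.val]

theorem LevelCode.val_lt_top (q : LevelCode) : q.val < ∞ := by
  rw [q.val_eq_coe]
  exact ENNReal.coe_lt_top

theorem LevelCode.val_lt_val {q r : LevelCode} :
    q.val < r.val ↔ q.1 * (r.2 + 1) < r.1 * (q.2 + 1) := by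
  rw [q.val_eq_coe, r.val_eq_coe, ENNReal.coe_lt_coe, div_lt_div_iff₀ (by positivity)
    (by positivity)]
  exact_mod_cast Iff.rfl

theorem LevelCode.val_le_val {q r : LevelCode} :
    q.val ≤ r.val ↔ q.1 * (r.2 + 1) ≤ r.1 * (q.2 + 1) := by
  rw [← not_lt, LevelCode.val_lt_val, not_lt]

theorem LevelCode.val_lt_iff {q : LevelCode} {x : ℝ≥0∞} :
    q.val < x ↔ (q.1 : ℝ≥0∞) < x * ((q.2 : ℝ≥0∞) + 1) := by
  unfold LevelCode.val
  exact ENNReal.div_lt_iff (by simp) (by simp)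

theorem LevelCode.exists_btwn {x y : ℝ≥0∞} (h : x < y) :
    ∃ q : LevelCode, x < q.val ∧ q.val < y := by
  obtain ⟨q, hq, h1, h2⟩ := ENNReal.lt_iff_exists_rat_btwn.1 h
  lift q to ℚ≥0 using hq
  have e : LevelCode.val (q.num, q.den - 1) = ((Real.toNNReal ((q : ℚ) : ℝ) : ℝ≥0) : ℝ≥0∞) := by
    rw [LevelCode.val_eq_coe, ENNReal.coe_inj]
    have hd : ((q.den - 1 : ℕ) : ℝ≥0) + 1 = q.den := by
      exact_mod_cast Nat.sub_add_cancel q.den_pos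
    ext
    rw [Real.coe_toNNReal _ (by positivity)]
    simp only [hd]
    have := congrArg (fun x : ℚ≥0 => (x : ℝ)) (NNRat.num_div_den q)
    push_cast at this ⊢
    exact this
  exact ⟨(q.num, q.den - 1), by rwa [e], by rwa [e]⟩

theorem LevelCode.iSup_val_lt (x : ℝ≥0∞) : ⨆ (q : LevelCode) (_ : q.val < x), q.val = x := by
  refine le_antisymm (iSup₂_le fun q hq => hq.le) (le_of_forall_lt fun y hy => ?_)
  obtain ⟨q, h1, h2⟩ := LevelCode.exists_btwn hy
  exact h1.trans_le (le_iSup₂_of_le q h2 le_rfl)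

/-! ### Lower semicomputable functions -/

section LowerSemicomputable

variable {Z I : Type*} [Primcodable I] {β : I → Set Z}

theorem uniformlyLowerSemicomputable_iff {ψ : ℕ → Z → ℝ≥0∞} :
    UniformlyLowerSemicomputable β ψ ↔
      REOpenFamily β fun x : ℕ × LevelCode => {z | x.2.val < ψ x.1 z} := by
  constructor
  · rintro ⟨A, hA, h⟩
    refine ⟨fun x => A (x.1.1, x.2, x.1.2), hA.comp (by fun_prop), fun a z => ?_⟩
    beta_reduce
    rw [h]
    simp
  · rintro ⟨A, hA, h⟩
    refine ⟨fun x => A ((x.1, x.2.2), x.2.1), hA.comp (by fun_prop), fun e q => ?_⟩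
    ext z
    rw [h (e, q) z]
    simp

theorem lowerSemicomputable_iff {f : Z → ℝ≥0∞} :
    LowerSemicomputable β f ↔ REOpenFamily β fun q : LevelCode => {z | q.val < f z} := by
  constructor
  · rintro ⟨A, hA, h⟩
    refine ⟨fun x => A (x.2, x.1), hA.comp (by fun_prop), fun a z => ?_⟩
    beta_reduce
    rw [h]
    simp
  · rintro ⟨A, hA, h⟩
    refine ⟨fun x => A (x.2, x.1), hA.comp (by fun_prop), fun q => ?_⟩
    ext z
    rw [h q z]
    simp

theorem UniformlyLowerSemicomputable.lowerSemicomputable {ψ : ℕ → Z → ℝ≥0∞}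
    (h : UniformlyLowerSemicomputable β ψ) (e : ℕ) : LowerSemicomputable β (ψ e) :=
  lowerSemicomputable_iff.2
    ((uniformlyLowerSemicomputable_iff.1 h).comp (f := fun q => (e, q)) (by fun_prop))

theorem LowerSemicomputable.uniformly_const {f : Z → ℝ≥0∞} (h : LowerSemicomputable β f) :
    UniformlyLowerSemicomputable β fun _ => f :=
  uniformlyLowerSemicomputable_iff.2
    ((lowerSemicomputable_iff.1 h).comp (f := fun x : ℕ × LevelCode => x.2) (by fun_prop))

theorem UniformlyLowerSemicomputable.iSup {ψ : ℕ → Z → ℝ≥0∞}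
    (h : UniformlyLowerSemicomputable β ψ) : LowerSemicomputable β fun z => ⨆ e, ψ e z := by
  have h1 := ((uniformlyLowerSemicomputable_iff.1 h).comp
    (f := fun x : LevelCode × ℕ => (x.2, x.1)) (by fun_prop)).iUnion
  exact lowerSemicomputable_iff.2 (h1.of_eq fun q z => by simp [lt_iSup_iff])

theorem UniformlyLowerSemicomputable.div_two_pow {ψ : ℕ → Z → ℝ≥0∞}
    (h : UniformlyLowerSemicomputable β ψ) {k : ℕ → ℕ} (hk : Primrec k) :
    UniformlyLowerSemicomputable β fun e z => ψ e z / 2 ^ k e := by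
  have h1 := (uniformlyLowerSemicomputable_iff.1 h).comp
    (f := fun x : ℕ × LevelCode => (x.1, (x.2.1 * 2 ^ k x.1, x.2.2))) (by fun_prop)
  refine uniformlyLowerSemicomputable_iff.2 (h1.of_eq fun x z => ?_)
  simp only [Set.mem_ofPred_eq]
  rw [ENNReal.lt_div_iff_mul_lt (by simp) (by simp)]
  unfold LevelCode.val
  push_cast
  rw [ENNReal.mul_div_right_comm]

/-! ### Acceptable enumerations -/

/-- The machine with code `e` halts on the input `a`. -/
def haltsOn (e : ℕ) {α : Type*} [Primcodable α] (a : α) : Prop :=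
  (Nat.Partrec.Code.eval (Denumerable.ofNat Nat.Partrec.Code e) (Encodable.encode a)).Dom

theorem rePred_haltsOn {α : Type*} [Primcodable α] :
    REPred fun x : ℕ × α => haltsOn x.1 x.2 :=
  (Nat.Partrec.Code.eval_part.comp ((Computable.ofNat _).comp Computable.fst)
    (Computable.encode.comp Computable.snd)).dom_re

/-- The s-m-n theorem for recursively enumerable predicates. -/
theorem _root_.REPred.exists_haltsOn {α : Type*} [Primcodable α] {p : ℕ × α → Prop}
    (hp : REPred p) : ∃ r : ℕ → ℕ, Computable r ∧ ∀ n a, haltsOn (r n) a ↔ p (n, a) := by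
  obtain ⟨c, hc⟩ := Nat.Partrec.Code.exists_code.1 hp
  refine ⟨fun n => Encodable.encode (Nat.Partrec.Code.curry c n), ?_, fun n a => ?_⟩
  · exact (Primrec.encode.comp
      (Nat.Partrec.Code.primrec₂_curry.comp (Primrec.const c) Primrec.id)).to_comp
  · have h : Nat.pair n (Encodable.encode a) = Encodable.encode (n, a) := by simp
    rw [haltsOn, Denumerable.ofNat_encode, Nat.Partrec.Code.eval_curry, h, hc]
    simp [Part.assert]

variable (β) in
/-- The universal sequence: the supremum of the levels `q` that the machine `e` allots to the basis
elements containing `z`. -/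
def universalSeq (e : ℕ) (z : Z) : ℝ≥0∞ :=
  ⨆ (x : I × LevelCode) (_ : haltsOn e x ∧ z ∈ β x.1), x.2.val

theorem uniformlyLowerSemicomputable_universalSeq :
    UniformlyLowerSemicomputable β (universalSeq β) := by
  have h1 : REOpenFamily β fun x : (ℕ × LevelCode) × I × LevelCode =>
      {z | (haltsOn x.1.1 x.2 ∧ x.1.2.val < x.2.2.val) ∧ z ∈ β x.2.1} := by
    refine (REOpenFamily.basis.comp (by fun_prop)).guard (REPred.and ?_ ?_)
    · exact rePred_haltsOn.comp (f := fun x : (ℕ × LevelCode) × I × LevelCode => (x.1.1, x.2))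
        (by fun_prop)
    · simp only [LevelCode.val_lt_val]
      exact (primrecPred_lt (by fun_prop) (by fun_prop)).to_re
  refine uniformlyLowerSemicomputable_iff.2 (h1.iUnion.of_eq fun x z => ?_)
  simp only [Set.mem_ofPred_eq, universalSeq, lt_iSup_iff]
  grind

variable (β) in
theorem isGoedelEnumeration_universalSeq : IsGoedelEnumeration β (universalSeq β) := by
  have key : ∀ ψ : ℕ → Z → ℝ≥0∞, UniformlyLowerSemicomputable β ψ →
      ∃ r : ℕ → ℕ, Computable r ∧ ∀ i, universalSeq β (r i) = ψ i := by
    rintro ψ ⟨A, hA, h⟩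
    obtain ⟨r, hr, hrA⟩ := hA.exists_haltsOn
    refine ⟨r, hr, fun i => funext fun z => ?_⟩
    have h2 : ∀ q : LevelCode, q.val < ψ i z ↔ ∃ j, A (i, j, q) ∧ z ∈ β j := fun q => by
      have := Set.ext_iff.1 (h i q) z
      simpa using this
    rw [← LevelCode.iSup_val_lt (ψ i z)]
    simp only [universalSeq, hrA, h2, iSup_exists]
    rw [iSup_prod, iSup_comm]
  refine ⟨uniformlyLowerSemicomputable_universalSeq, fun f hf => ?_, key⟩
  obtain ⟨r, -, h⟩ := key _ hf.uniformly_const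
  exact ⟨r 0, h 0⟩

end LowerSemicomputable

/-- A recursively enumerable predicate is enumerated in finite stages, uniformly in a parameter. -/
theorem _root_.REPred.exists_stages {δ : Type*} [Primcodable δ] {p : ℕ × δ → Prop}
    (hp : REPred p) : ∃ L : ℕ → ℕ → List δ, Primrec (fun x : ℕ × ℕ => L x.1 x.2) ∧
      (∀ e m n, m ≤ n → L e m ⊆ L e n) ∧ ∀ e d, p (e, d) ↔ ∃ n, d ∈ L e n := by
  classical
  obtain ⟨R, hR, -, eR⟩ := hp.exists_primrecRel
  let g : ℕ → ℕ → Option δ := fun e k => (Encodable.decode (α := δ × ℕ) k).bind fun x =>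
    if R (e, x.1) x.2 then some x.1 else none
  have hg : Primrec fun x : ℕ × ℕ => g x.1 x.2 := by
    refine Primrec.option_bind (Primrec.decode.comp Primrec.snd) ?_
    exact Primrec.ite (c := fun y : (ℕ × ℕ) × δ × ℕ => R (y.1.1, y.2.1) y.2.2)
      (hR.comp (f := fun y : (ℕ × ℕ) × δ × ℕ => (y.1.1, y.2.1)) (by fun_prop) (by fun_prop))
      (Primrec.option_some.comp (by fun_prop)) (Primrec.const none)
  refine ⟨fun e n => (List.range n).filterMap (g e), ?_, ?_, ?_⟩
  · have : Primrec fun y : (ℕ × ℕ) × ℕ => g y.1.1 y.2 :=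
      hg.comp (f := g.uncurry) (g := fun y : (ℕ × ℕ) × ℕ => (y.1.1, y.2)) (by fun_prop)
    fun_prop
  · intro e m n hmn d
    simp only [List.mem_filterMap, List.mem_range]
    exact fun ⟨k, hk, hd⟩ => ⟨k, hk.trans_le hmn, hd⟩
  · intro e d
    simp only [eR, List.mem_filterMap, List.mem_range, g, Option.bind_eq_some_iff]
    constructor
    · rintro ⟨k, hk⟩
      exact ⟨_, _, Nat.lt_succ_self _, (d, k), Encodable.encodek _, by simp [hk]⟩
    · rintro ⟨n, k, -, x, -, hx⟩
      by_cases h : R (e, x.1) x.2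
      · simp only [h, if_true, Option.some.injEq] at hx
        exact ⟨x.2, hx ▸ h⟩
      · simp [h] at hx

/-! ### Arithmetic of rational codes -/

/-- A code of the sum of two rational numbers. -/
def RatCode.add (q r : RatCode) : RatCode :=
  (q.1 * (r.2.2 + 1) + r.1 * (q.2.2 + 1), q.2.1 * (r.2.2 + 1) + r.2.1 * (q.2.2 + 1),
    q.2.2 * r.2.2 + q.2.2 + r.2.2)

/-- A code of the difference of two rational numbers. -/
def RatCode.sub (q r : RatCode) : RatCode := q.add (r.2.1, r.1, r.2.2)

theorem RatCode.val_add (q r : RatCode) : (q.add r).val = q.val + r.val := by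
  simp only [RatCode.val, RatCode.add]
  have h1 : (q.2.2 : ℚ) + 1 ≠ 0 := by positivity
  have h2 : (r.2.2 : ℚ) + 1 ≠ 0 := by positivity
  have h3 : ((q.2.2 * r.2.2 + q.2.2 + r.2.2 : ℕ) : ℚ) + 1 = (q.2.2 + 1) * (r.2.2 + 1) := by
    push_cast; ring
  rw [h3]
  push_cast
  field_simp
  ring

theorem RatCode.val_sub (q r : RatCode) : (q.sub r).val = q.val - r.val := by
  rw [RatCode.sub, RatCode.val_add]
  simp only [RatCode.val]
  ring

/-- A code of `1 / (n + 1)`. -/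
def RatCode.invSucc (n : ℕ) : RatCode := (1, 0, n)

theorem RatCode.val_invSucc (n : ℕ) :
    (((RatCode.invSucc n).val : ℚ) : ℝ) = 1 / ((n : ℝ) + 1) := by
  simp [RatCode.val, RatCode.invSucc]

section

variable {α : Type*} [Primcodable α]

@[fun_prop]
theorem RatCode.primrec_add {f g : α → RatCode} (hf : Primrec f) (hg : Primrec g) :
    Primrec fun a => (f a).add (g a) := by
  unfold RatCode.add
  fun_prop

@[fun_prop]
theorem RatCode.primrec_sub {f g : α → RatCode} (hf : Primrec f) (hg : Primrec g) :
    Primrec fun a => (f a).sub (g a) := by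
  unfold RatCode.sub
  fun_prop

@[fun_prop]
theorem RatCode.primrec_invSucc {f : α → ℕ} (hf : Primrec f) :
    Primrec fun a => RatCode.invSucc (f a) := by
  unfold RatCode.invSucc
  fun_prop

end

theorem eventually_lt_sub_of_lt {a b : ℝ} (h : a < b) (c : ℝ) :
    ∀ᶠ n : ℕ in atTop, a < b - c * (1 / ((n : ℝ) + 1)) := by
  have h1 : Tendsto (fun n : ℕ => b - c * (1 / ((n : ℝ) + 1))) atTop (𝓝 (b - c * 0)) :=
    tendsto_const_nhds.sub (tendsto_one_div_add_atTop_nhds_zero_nat.const_mul c)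
  simp only [mul_zero, sub_zero] at h1
  exact h1.eventually_const_lt h

theorem eventually_forall_mem_list {κ : Type*} {l : List κ} {p : κ → ℕ → Prop} :
    (∀ᶠ n in atTop, ∀ k ∈ l, p k n) ↔ ∀ k ∈ l, ∀ᶠ n in atTop, p k n :=
  eventually_all_finite (I := {k | k ∈ l}) l.finite_toSet

/-! ### Regular bases -/

/-- An effective form of regularity: every basis element `β i` is exhausted by the basis elements
`β (sh (i, n))`, and these are separated from its complement by the closed sets `C (sh (i, n))`,
whose complements are recursively enumerable open sets. -/
structure EffectivelyRegular {I Z : Type*} [Primcodable I] (β C : I → Set Z) (sh : I × ℕ → I) :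
    Prop where
  primrec : Primrec sh
  compl : REOpenFamily β fun i => (C i)ᶜ
  subset_closed (i : I) : β i ⊆ C i
  closed_subset (i : I) (n : ℕ) : C (sh (i, n)) ⊆ β i
  eventually_mem (i : I) (z : Z) : z ∈ β i → ∀ᶠ n in atTop, z ∈ β (sh (i, n))

section Product

variable {α Z W I J : Type*} [Primcodable α] [Primcodable I] [Primcodable J]
  {β C : I → Set Z} {γ D : J → Set W} {sh : I × ℕ → I} {sh' : J × ℕ → J}

theorem REOpenFamily.prod {U : α → Set Z} {V : α → Set W} (hU : REOpenFamily β U)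
    (hV : REOpenFamily γ V) : REOpenFamily (prodBasis β γ) fun a => U a ×ˢ V a := by
  obtain ⟨A, hA, hU⟩ := hU
  obtain ⟨B, hB, hV⟩ := hV
  refine ⟨fun x => A (x.1, x.2.1) ∧ B (x.1, x.2.2),
    (hA.comp (f := fun x : α × I × J => (x.1, x.2.1)) (by fun_prop)).and
      (hB.comp (f := fun x : α × I × J => (x.1, x.2.2)) (by fun_prop)), fun a z => ?_⟩
  simp only [Set.mem_prod, hU, hV, prodBasis, Prod.exists]
  grind

theorem HasEffectiveInter.prod (hβ : HasEffectiveInter β) (hγ : HasEffectiveInter γ) :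
    HasEffectiveInter (prodBasis β γ) := by
  refine (REOpenFamily.prod (hβ.comp (f := fun l : List (I × J) => l.map Prod.fst) (by fun_prop))
    (hγ.comp (f := fun l : List (I × J) => l.map Prod.snd) (by fun_prop))).of_eq fun l z => ?_
  simp only [Set.mem_prod, Set.mem_ofPred_eq, prodBasis, List.mem_map]
  grind

theorem REOpenFamily.preimage_fst (hγ : HasEffectiveInter γ) {U : α → Set Z}
    (hU : REOpenFamily β U) : REOpenFamily (prodBasis β γ) fun a => {z | z.1 ∈ U a} :=
  (hU.prod (REOpenFamily.univ hγ)).of_eq (by simp)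

theorem REOpenFamily.preimage_snd (hβ : HasEffectiveInter β) {U : α → Set W}
    (hU : REOpenFamily γ U) : REOpenFamily (prodBasis β γ) fun a => {z | z.2 ∈ U a} :=
  ((REOpenFamily.univ hβ).prod hU).of_eq (by simp)

theorem EffectivelyRegular.prod (hβ : HasEffectiveInter β) (hγ : HasEffectiveInter γ)
    (h : EffectivelyRegular β C sh) (h' : EffectivelyRegular γ D sh') :
    EffectivelyRegular (prodBasis β γ) (prodBasis C D)
      fun x => (sh (x.1.1, x.2), sh' (x.1.2, x.2)) where
  primrec := by
    have := h.primrec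
    have := h'.primrec
    fun_prop
  compl := by
    have h1 := (h.compl.preimage_fst hγ).comp (f := fun x : I × J => x.1) (by fun_prop)
    have h2 := (h'.compl.preimage_snd hβ).comp (f := fun x : I × J => x.2) (by fun_prop)
    refine (h1.union h2).of_eq fun x z => ?_
    simp only [Set.mem_ofPred_eq, Set.mem_compl_iff, prodBasis, Set.mem_prod]
    tauto
  subset_closed i := Set.prod_mono (h.subset_closed _) (h'.subset_closed _)
  closed_subset i n := Set.prod_mono (h.closed_subset _ n) (h'.closed_subset _ n)
  eventually_mem i z hz :=
    (h.eventually_mem _ _ hz.1).and (h'.eventually_mem _ _ hz.2)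

end Product

/-! ### The balls of a computable metric space -/

section Ball

variable (X : Type*) [MetricSpace X] [ComputableMetricSpace X]

theorem hasEffectiveInter_ballBasis : HasEffectiveInter (ballBasis X) := by
  -- `A (p, q)` says that the ball `q` is formally contained in the ball `p`
  let A : (ℕ × RatCode) × (ℕ × RatCode) → Prop := fun x =>
    dist (ComputableMetricSpace.pt (X := X) x.1.1) (ComputableMetricSpace.pt x.2.1) <
      (((x.1.2.sub x.2.2).val : ℚ) : ℝ)
  have hA : REPred A := (ComputableMetricSpace.re_dist_lt (X := X)).comp
    (f := fun x : (ℕ × RatCode) × (ℕ × RatCode) => ((x.1.1, x.2.1), x.1.2.sub x.2.2))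
    (by fun_prop)
  refine ⟨fun x => ∀ p ∈ x.1, A (p, x.2), ?_, fun l z => ?_⟩
  · have h1 := REPred.forall_mem (p := fun x : (ℕ × RatCode) × (ℕ × RatCode) => A (x.2, x.1))
      (hA.comp (by fun_prop))
    exact h1.comp (f := fun x : List (ℕ × RatCode) × (ℕ × RatCode) => (x.2, x.1)) (by fun_prop)
  · simp only [Set.mem_ofPred_eq, ballBasis, Metric.mem_ball, A, RatCode.val_sub, Rat.cast_sub]
    constructor
    · intro h
      obtain ⟨n, hn⟩ := (eventually_forall_mem_list.2 fun p hp =>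
        eventually_lt_sub_of_lt (h p hp) 2).exists
      have hpos : (0 : ℝ) < 1 / ((n : ℝ) + 1) := by positivity
      obtain ⟨c, hc⟩ := (ComputableMetricSpace.dense_pt (X := X)).exists_dist_lt z hpos
      refine ⟨(c, RatCode.invSucc n), fun p hp => ?_, ?_⟩
      · rw [RatCode.val_invSucc]
        have h1 := hn p hp
        have h2 := dist_triangle (ComputableMetricSpace.pt (X := X) p.1) z
          (ComputableMetricSpace.pt c)
        rw [dist_comm _ z] at h2
        linarith
      · rw [RatCode.val_invSucc]
        exact hc
    · rintro ⟨q, hq, hz⟩ p hp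
      have h1 := hq p hp
      have h2 := dist_triangle z (ComputableMetricSpace.pt q.1) (ComputableMetricSpace.pt p.1)
      rw [dist_comm (ComputableMetricSpace.pt p.1)] at h1
      linarith

/-- The closed ball with a given code. -/
def closedBalls : ℕ × RatCode → Set X :=
  fun p => Metric.closedBall (ComputableMetricSpace.pt p.1) ((p.2.val : ℚ) : ℝ)

/-- The ball with the same center and with the radius diminished by `1 / (n + 1)`. -/
def shrinkBall (x : (ℕ × RatCode) × ℕ) : ℕ × RatCode :=
  (x.1.1, x.1.2.sub (RatCode.invSucc x.2))

theorem effectivelyRegular_ballBasis :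
    EffectivelyRegular (ballBasis X) (closedBalls X) shrinkBall where
  primrec := by unfold shrinkBall; fun_prop
  compl := by
    let A : (ℕ × RatCode) × (ℕ × RatCode) → Prop := fun x =>
      (((x.1.2.add x.2.2).val : ℚ) : ℝ) <
        dist (ComputableMetricSpace.pt (X := X) x.1.1) (ComputableMetricSpace.pt x.2.1)
    have hA : REPred A := (ComputableMetricSpace.re_lt_dist (X := X)).comp
      (f := fun x : (ℕ × RatCode) × (ℕ × RatCode) => ((x.1.1, x.2.1), x.1.2.add x.2.2))
      (by fun_prop)
    refine ⟨A, hA, fun p z => ?_⟩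
    simp only [Set.mem_compl_iff, closedBalls, Metric.mem_closedBall, not_le, A, RatCode.val_add,
      Rat.cast_add, ballBasis, Metric.mem_ball]
    constructor
    · intro h
      obtain ⟨n, hn⟩ := (eventually_lt_sub_of_lt h 2).exists
      have hpos : (0 : ℝ) < 1 / ((n : ℝ) + 1) := by positivity
      obtain ⟨c, hc⟩ := (ComputableMetricSpace.dense_pt (X := X)).exists_dist_lt z hpos
      refine ⟨(c, RatCode.invSucc n), ?_, ?_⟩
      · rw [RatCode.val_invSucc]
        have h2 := dist_triangle z (ComputableMetricSpace.pt (X := X) c)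
          (ComputableMetricSpace.pt p.1)
        rw [dist_comm (ComputableMetricSpace.pt c)] at h2
        linarith
      · rw [RatCode.val_invSucc]
        exact hc
    · rintro ⟨q, hq, hz⟩
      have h2 := dist_triangle (ComputableMetricSpace.pt (X := X) p.1) z
        (ComputableMetricSpace.pt q.1)
      rw [dist_comm _ z] at h2
      linarith
  subset_closed p := Metric.ball_subset_closedBall
  closed_subset p n := by
    refine Metric.closedBall_subset_ball ?_
    have hpos : (0 : ℝ) < 1 / ((n : ℝ) + 1) := by positivity
    simp only [shrinkBall, RatCode.val_sub, Rat.cast_sub, RatCode.val_invSucc]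
    linarith
  eventually_mem p z hz := by
    filter_upwards [eventually_lt_sub_of_lt hz 1] with n hn
    simpa only [ballBasis, Metric.mem_ball, shrinkBall, RatCode.val_sub, Rat.cast_sub,
      RatCode.val_invSucc, one_mul] using hn

end Ball

/-! ### The basis of the space of probability measures -/

section Measures

variable (X : Type*) [MetricSpace X] [ComputableMetricSpace X] [MeasurableSpace X]

/-- The codes of the conditions that define the basis elements of the space of measures. -/
abbrev MeasCode : Type := List (ℕ × RatCode × ℕ) × RatCode × Bool

variable {X} in
theorem mem_measSubbasis_true {L : List (ℕ × RatCode × ℕ)} {r : RatCode}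
    {μ : ProbabilityMeasure X} :
    μ ∈ measSubbasis X (L, r, true) ↔ ((r.val : ℚ) : ℝ) < ∫ x, hatMax L x ∂(μ : Measure X) :=
  Iff.rfl

variable {X} in
theorem mem_measSubbasis_false {L : List (ℕ × RatCode × ℕ)} {r : RatCode}
    {μ : ProbabilityMeasure X} :
    μ ∈ measSubbasis X (L, r, false) ↔ ∫ x, hatMax L x ∂(μ : Measure X) < ((r.val : ℚ) : ℝ) :=
  Iff.rfl

theorem hasEffectiveInter_measBasis : HasEffectiveInter (measBasis X) := by
  refine (REOpenFamily.basis.comp (f := fun l : List (List MeasCode) => l.flatten)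
    Primrec.list_flatten).of_eq fun l μ => ?_
  simp only [measBasis, Set.mem_ofPred_eq, List.mem_flatten]
  grind

/-- The opposite strict inequality. -/
def MeasCode.opp (k : MeasCode) : MeasCode := (k.1, k.2.1, !k.2.2)

/-- The measures satisfying the conditions of a basis element with weak inequalities. -/
def closedMeas (l : List MeasCode) : Set (ProbabilityMeasure X) :=
  {μ | ∀ k ∈ l, μ ∉ measSubbasis X k.opp}

/-- The same conditions, with each bound made stricter by `1 / (n + 1)`. -/
def shrinkMeas (x : List MeasCode × ℕ) : List MeasCode :=
  x.1.map fun k => (k.1, bif k.2.2 then k.2.1.add (RatCode.invSucc x.2) else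
    k.2.1.sub (RatCode.invSucc x.2), k.2.2)

theorem effectivelyRegular_measBasis :
    EffectivelyRegular (measBasis X) (closedMeas X) shrinkMeas where
  primrec := by
    unfold shrinkMeas
    have : Primrec fun y : (List MeasCode × ℕ) × MeasCode =>
        bif y.2.2.2 then y.2.2.1.add (RatCode.invSucc y.1.2) else
          y.2.2.1.sub (RatCode.invSucc y.1.2) :=
      Primrec.cond (by fun_prop) (by fun_prop) (by fun_prop)
    fun_prop
  compl := by
    have h1 : REOpenFamily (measBasis X) fun x : List MeasCode × MeasCode =>
        {μ | x.2 ∈ x.1 ∧ μ ∈ measBasis X [x.2.opp]} :=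
      (REOpenFamily.basis.comp (by unfold MeasCode.opp; fun_prop)).guard
        (primrecPred_mem (by fun_prop) (by fun_prop)).to_re
    refine h1.iUnion.of_eq fun l μ => ?_
    simp only [Set.mem_ofPred_eq, Set.mem_compl_iff, measBasis, closedMeas, List.mem_singleton,
      forall_eq, not_forall, not_not, exists_prop]
  subset_closed l μ h k hk := by
    have h1 := h k hk
    obtain ⟨L, r, b⟩ := k
    cases b
    · exact fun h2 => lt_asymm (mem_measSubbasis_false.1 h1) (mem_measSubbasis_true.1 h2)
    · exact fun h2 => lt_asymm (mem_measSubbasis_true.1 h1) (mem_measSubbasis_false.1 h2)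
  closed_subset l n μ h k hk := by
    have h1 := h _ (List.mem_map_of_mem hk)
    have hpos : (0 : ℝ) < 1 / ((n : ℝ) + 1) := by positivity
    obtain ⟨L, r, b⟩ := k
    cases b
    · simp only [MeasCode.opp, cond_false, Bool.not_false, mem_measSubbasis_true, RatCode.val_sub,
        Rat.cast_sub, RatCode.val_invSucc] at h1
      rw [mem_measSubbasis_false]
      linarith
    · simp only [MeasCode.opp, cond_true, Bool.not_true, mem_measSubbasis_false, RatCode.val_add,
        Rat.cast_add, RatCode.val_invSucc] at h1
      rw [mem_measSubbasis_true]
      linarith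
  eventually_mem l μ h := by
    simp only [measBasis, shrinkMeas, Set.mem_ofPred_eq, List.forall_mem_map]
    refine eventually_forall_mem_list.2 fun k hk => ?_
    have h1 := h k hk
    obtain ⟨L, r, b⟩ := k
    cases b
    · filter_upwards [eventually_lt_sub_of_lt (mem_measSubbasis_false.1 h1) 1] with n hn
      simp only [cond_false, mem_measSubbasis_false, RatCode.val_sub, Rat.cast_sub,
        RatCode.val_invSucc]
      linarith
    · filter_upwards [eventually_lt_sub_of_lt (mem_measSubbasis_true.1 h1) 1] with n hn
      simp only [cond_true, mem_measSubbasis_true, RatCode.val_add, Rat.cast_add,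
        RatCode.val_invSucc]
      linarith

theorem reOpenFamily_integral_hatMax :
    REOpenFamily (measBasis X) fun x : List (ℕ × RatCode × ℕ) × RatCode =>
      {μ : ProbabilityMeasure X |
        ((x.2.val : ℚ) : ℝ) < ∫ y, hatMax x.1 y ∂(μ : Measure X)} :=
  (REOpenFamily.basis.comp (f := fun x : List (ℕ × RatCode × ℕ) × RatCode =>
    [(x.1, x.2, true)]) (by fun_prop)).of_eq fun x μ => by
      simp [measBasis, mem_measSubbasis_true]

end Measures

/-! ### Measures of sections of recursively enumerable open sets -/

section Hat

variable {X : Type*} [MetricSpace X]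

theorem hat_le_one {u : X} {r ε : ℝ} (hε : 0 ≤ ε) (x : X) : hat u r ε x ≤ 1 :=
  max_le (by linarith [div_nonneg (le_max_right (dist x u - r) 0) hε]) zero_le_one

theorem hat_eq_one {u : X} {r ε : ℝ} {x : X} (h : dist x u ≤ r) : hat u r ε x = 1 := by
  simp [hat, max_eq_right (sub_nonpos.2 h)]

theorem hat_eq_zero {u : X} {r ε : ℝ} (hε : 0 < ε) {x : X} (h : r + ε ≤ dist x u) :
    hat u r ε x = 0 := by
  refine max_eq_right (sub_nonpos.2 ((one_le_div hε).2 (le_max_of_le_left ?_)))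
  linarith

variable [ComputableMetricSpace X]

theorem hatMax_nonneg (L : List (ℕ × RatCode × ℕ)) (x : X) : 0 ≤ hatMax L x := by
  cases L with
  | nil => exact le_rfl
  | cons k L => exact le_max_of_le_left (le_max_right _ _)

theorem hatMax_le_one (L : List (ℕ × RatCode × ℕ)) (x : X) : hatMax L x ≤ 1 := by
  induction L with
  | nil => exact zero_le_one
  | cons k L ih => exact max_le (hat_le_one (by positivity) x) ih

theorem continuous_hatMax (L : List (ℕ × RatCode × ℕ)) :
    Continuous (hatMax L : X → ℝ) := by
  induction L with
  | nil => exact continuous_const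
  | cons k L ih =>
    refine Continuous.max ?_ ih
    unfold hat
    fun_prop

/-- The `n`-th approximation from below to the indicator function of a finite union of balls. -/
def approxHats (L : List (ℕ × RatCode)) (n : ℕ) : List (ℕ × RatCode × ℕ) :=
  L.map fun p => (p.1, p.2.sub (RatCode.invSucc n), n)

theorem hatMax_approxHats_eq_zero {L : List (ℕ × RatCode)} {n : ℕ} {x : X}
    (h : ∀ p ∈ L, x ∉ ballBasis X p) : hatMax (approxHats L n) x = 0 := by
  induction L with
  | nil => rfl
  | cons p L ih =>
    rw [List.forall_mem_cons] at h
    have h1 := ih h.2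
    have h2 : hat (ComputableMetricSpace.pt p.1)
        (((p.2.sub (RatCode.invSucc n)).val : ℚ) : ℝ) (1 / ((n : ℝ) + 1)) x = 0 := by
      refine hat_eq_zero (by positivity) ?_
      have := h.1
      simp only [ballBasis, Metric.mem_ball, not_lt] at this
      simpa [RatCode.val_sub, RatCode.val_invSucc] using this
    simp only [approxHats, List.map_cons, hatMax] at h1 ⊢
    rw [h1, h2, max_self]

theorem eventually_hatMax_approxHats_eq_one {L : List (ℕ × RatCode)} {x : X}
    {p : ℕ × RatCode} (hp : p ∈ L) (hx : x ∈ ballBasis X p) :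
    ∀ᶠ n in atTop, hatMax (approxHats L n) x = 1 := by
  filter_upwards [eventually_lt_sub_of_lt hx 1] with n hn
  refine le_antisymm (hatMax_le_one _ _) ?_
  induction L with
  | nil => simp at hp
  | cons q L ih =>
    rcases List.mem_cons.1 hp with rfl | hp
    · refine le_max_of_le_left (hat_eq_one ?_).ge
      simpa only [RatCode.val_sub, Rat.cast_sub, RatCode.val_invSucc, one_mul] using hn.le
    · exact le_max_of_le_right (ih hp)

variable [MeasurableSpace X] (μ : Measure X) [IsProbabilityMeasure μ]

theorem integral_hatMax_approxHats_le (L : List (ℕ × RatCode)) (n : ℕ) {S : Set X}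
    (hS : MeasurableSet S) (h : ∀ p ∈ L, ballBasis X p ⊆ S) :
    ∫ x, hatMax (approxHats L n) x ∂μ ≤ μ.real S := by
  rw [← integral_indicator_one hS]
  refine integral_mono_of_nonneg (.of_forall fun x => hatMax_nonneg _ x)
    ((integrable_const (1 : ℝ)).indicator hS) (.of_forall fun x => ?_)
  by_cases hx : x ∈ S
  · simpa [hx] using hatMax_le_one _ x
  · simp only [hx, not_false_eq_true, Set.indicator_of_notMem]
    exact (hatMax_approxHats_eq_zero fun p hp hxp => hx (h p hp hxp)).le

theorem tendsto_integral_hatMax_approxHats [BorelSpace X] (L : List (ℕ × RatCode)) :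
    Tendsto (fun n => ∫ x, hatMax (approxHats L n) x ∂μ) atTop
      (𝓝 (μ.real (⋃ p ∈ L, ballBasis X p))) := by
  have hS : MeasurableSet (⋃ p ∈ L, ballBasis X p) :=
    (isOpen_biUnion fun p _ => Metric.isOpen_ball).measurableSet
  rw [← integral_indicator_one hS]
  refine tendsto_integral_of_dominated_convergence (fun _ => 1)
    (fun n => (continuous_hatMax _).aestronglyMeasurable) (integrable_const 1)
    (fun n => .of_forall fun x => ?_) (.of_forall fun x => ?_)
  · rw [Real.norm_of_nonneg (hatMax_nonneg _ x)]
    exact hatMax_le_one _ x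
  · by_cases hx : x ∈ ⋃ p ∈ L, ballBasis X p
    · simp only [hx, Set.indicator_of_mem, Pi.one_apply]
      obtain ⟨p, hp, hxp⟩ := Set.mem_iUnion₂.1 hx
      exact tendsto_const_nhds.congr' ((eventually_hatMax_approxHats_eq_one hp hxp).mono
        fun n hn => hn.symm)
    · simp only [hx, not_false_eq_true, Set.indicator_of_notMem]
      refine tendsto_const_nhds.congr fun n => (hatMax_approxHats_eq_zero fun p hp hxp => hx ?_).symm
      exact Set.mem_iUnion₂.2 ⟨p, hp, hxp⟩

end Hat

theorem tendsto_measureReal_biUnion_finset {X ι : Type*} [Countable ι] [MeasurableSpace X]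
    (μ : Measure X) [IsFiniteMeasure μ] (s : ι → Set X) :
    Tendsto (fun F : Finset ι => μ.real (⋃ i ∈ F, s i)) atTop (𝓝 (μ.real (⋃ i, s i))) := by
  have h : Monotone fun F : Finset ι => ⋃ i ∈ F, s i := fun F G hFG =>
    Set.biUnion_subset_biUnion_left hFG
  have h1 := tendsto_measure_iUnion_atTop (μ := μ) h
  rw [← Set.iUnion_eq_iUnion_finset] at h1
  exact (ENNReal.tendsto_toReal (measure_ne_top μ _)).comp h1

/-- A space of parameters `p`, with an enumerated basis `π`, on which a probability measure `m p`
on `X` depends effectively. -/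
structure IsEffectiveParameter {X P J : Type*} [MetricSpace X] [ComputableMetricSpace X]
    [MeasurableSpace X] [Primcodable J] (π : J → Set P) (m : P → ProbabilityMeasure X) : Prop where
  inter : HasEffectiveInter π
  regular : ∃ (D : J → Set P) (sh : J × ℕ → J), EffectivelyRegular π D sh
  integral_hatMax : REOpenFamily π fun x : List (ℕ × RatCode × ℕ) × RatCode =>
    {p | ((x.2.val : ℚ) : ℝ) < ∫ y, hatMax x.1 y ∂(m p : Measure X)}

section Sections

variable {α X P J : Type*} [Primcodable α] [MetricSpace X] [ComputableMetricSpace X]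
  [Primcodable J] {π : J → Set P}

theorem REOpenFamily.isOpen_section {U : α → Set (X × P)}
    (hU : REOpenFamily (prodBasis (ballBasis X) π) U) (a : α) (p : P) :
    IsOpen {x | (x, p) ∈ U a} := by
  obtain ⟨A, -, hU⟩ := hU
  have h : {x | (x, p) ∈ U a} = ⋃ (w : (ℕ × RatCode) × J) (_ : A (a, w) ∧ p ∈ π w.2),
      ballBasis X w.1 := by
    ext x
    simp only [Set.mem_ofPred_eq, hU, prodBasis, Set.mem_prod, Set.mem_iUnion, exists_prop]
    grind
  rw [h]
  exact isOpen_iUnion fun w => isOpen_iUnion fun _ => Metric.isOpen_ball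

variable [MeasurableSpace X] [BorelSpace X] {m : P → ProbabilityMeasure X}

/-- The measure of a section exceeds `r` if and only if, for some finite list `k.1` of basis
elements of `X × P`
contained in the set, whose second factors contain `p`, the integral of an
approximation to the indicator function of the union of their first factors does. -/
theorem lt_measureReal_section_iff {A : α × (ℕ × RatCode) × J → Prop} {U : α → Set (X × P)}
    (hA : REPred A)
    (hU : ∀ a z, z ∈ U a ↔ ∃ w, A (a, w) ∧ z ∈ prodBasis (ballBasis X) π w)
    (a : α) (r : ℝ) (p : P) :
    r < (m p : Measure X).real {x | (x, p) ∈ U a} ↔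
      ∃ k : List ((ℕ × RatCode) × J) × ℕ, (∀ w ∈ k.1, A (a, w)) ∧
        (∀ j ∈ k.1.map Prod.snd, p ∈ π j) ∧
        r < ∫ x, hatMax (approxHats (k.1.map Prod.fst) k.2) x ∂(m p : Measure X) := by
  constructor
  · intro hr
    have h : {x | (x, p) ∈ U a} = ⋃ w : {w : (ℕ × RatCode) × J // A (a, w) ∧ p ∈ π w.2},
        ballBasis X w.1.1 := by
      ext x
      simp only [Set.mem_ofPred_eq, hU, prodBasis, Set.mem_prod, Set.mem_iUnion,
        Subtype.exists, exists_prop]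
      grind
    rw [h] at hr
    obtain ⟨F, hF⟩ := ((tendsto_measureReal_biUnion_finset (m p : Measure X) _).eventually_const_lt
      hr).exists
    let L := F.toList.map Subtype.val
    have hL : (⋃ w ∈ F, ballBasis X w.1.1) = ⋃ q ∈ L.map Prod.fst, ballBasis X q := by
      ext x
      simp only [L, Set.mem_iUnion, List.mem_map, Finset.mem_toList, exists_prop]
      grind
    rw [hL] at hF
    obtain ⟨n, hn⟩ := ((tendsto_integral_hatMax_approxHats (m p : Measure X) _).eventually_const_lt
      hF).exists
    refine ⟨(L, n), ?_, ?_, hn⟩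
    · simp only [L, List.mem_map]
      rintro _ ⟨w, -, rfl⟩
      exact w.2.1
    · simp only [L, List.mem_map]
      rintro _ ⟨_, ⟨w, -, rfl⟩, rfl⟩
      exact w.2.2
  · rintro ⟨⟨L, n⟩, hLA, hLp, hr⟩
    refine hr.trans_le (integral_hatMax_approxHats_le _ _ _
      (REOpenFamily.isOpen_section ⟨A, hA, hU⟩ a p).measurableSet ?_)
    simp only [List.mem_map]
    rintro _ ⟨w, hw, rfl⟩ x hx
    exact (hU _ _).2 ⟨w, hLA w hw, hx, hLp _ (List.mem_map_of_mem hw)⟩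

/-- The measure of a section of a recursively enumerable open set is lower semicomputable in the
parameter. -/
theorem REOpenFamily.lt_measureReal_section (hm : IsEffectiveParameter π m) {U : α → Set (X × P)}
    (hU : REOpenFamily (prodBasis (ballBasis X) π) U) :
    REOpenFamily π fun x : α × RatCode =>
      {p | ((x.2.val : ℚ) : ℝ) < (m p : Measure X).real {y | (y, p) ∈ U x.1}} := by
  obtain ⟨A, hA, hU⟩ := hU
  have h1 : REPred fun x : (α × RatCode) × List ((ℕ × RatCode) × J) × ℕ =>
      ∀ w ∈ x.2.1, A (x.1.1, w) :=
    hA.forall_mem.comp (f := fun x : (α × RatCode) × List ((ℕ × RatCode) × J) × ℕ =>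
      (x.1.1, x.2.1)) (by fun_prop)
  have h2 := hm.inter.comp (f := fun x : (α × RatCode) × List ((ℕ × RatCode) × J) × ℕ =>
      x.2.1.map Prod.snd) (by fun_prop)
  have h3 := hm.integral_hatMax.comp
    (f := fun x : (α × RatCode) × List ((ℕ × RatCode) × J) × ℕ =>
      (approxHats (x.2.1.map Prod.fst) x.2.2, x.1.2)) (by unfold approxHats; fun_prop)
  refine ((h2.inter hm.inter h3).guard h1).iUnion.of_eq fun x p => ?_
  simp only [Set.mem_ofPred_eq]
  exact (lt_measureReal_section_iff hA hU x.1 _ p).symm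

end Sections

/-! ### Step functions -/

section Steps

variable {Z K : Type*}

/-- The maximum of the levels `q` over the entries `(i, q)` of the list with `z ∈ B i`. -/
def stepSup (B : K → Set Z) (L : List (K × LevelCode)) (z : Z) : ℝ≥0∞ :=
  ⨆ (x : K × LevelCode) (_ : x ∈ L) (_ : z ∈ B x.1), x.2.val

theorem stepSup_le_iff {B : K → Set Z} {L : List (K × LevelCode)} {z : Z} {t : ℝ≥0∞} :
    stepSup B L z ≤ t ↔ ∀ x ∈ L, z ∈ B x.1 → x.2.val ≤ t := by
  simp [stepSup]

theorem lt_stepSup_iff {B : K → Set Z} {L : List (K × LevelCode)} {z : Z} {t : ℝ≥0∞} :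
    t < stepSup B L z ↔ ∃ x ∈ L, z ∈ B x.1 ∧ t < x.2.val := by
  simp only [stepSup, lt_iSup_iff, exists_prop]

theorem stepSup_mono {B C : K → Set Z} (h : ∀ i, B i ⊆ C i) {L L' : List (K × LevelCode)}
    (hL : L ⊆ L') (z : Z) : stepSup B L z ≤ stepSup C L' z :=
  stepSup_le_iff.2 fun x hx hz => stepSup_le_iff.1 le_rfl x (hL hx) (h _ hz)

theorem REOpenFamily.stepSup_le {I : Type*} [Primcodable I] [Primcodable K] {β : I → Set Z}
    {C : K → Set Z} (hβ : HasEffectiveInter β)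
    (hC : REOpenFamily β fun i => (C i)ᶜ) :
    REOpenFamily β fun x : List (K × LevelCode) × LevelCode =>
      {z | stepSup C x.1 z ≤ x.2.val} := by
  have h1 : REOpenFamily β fun x : LevelCode × K × LevelCode =>
      {z | (x.2.2.val ≤ x.1.val ∧ z ∈ Set.univ) ∨ z ∈ (C x.2.1)ᶜ} := by
    refine ((REOpenFamily.univ hβ).guard ?_).union (hC.comp (by fun_prop))
    simp only [LevelCode.val_le_val]
    exact (primrecPred_le (by fun_prop) (by fun_prop)).to_re
  refine ((h1.forall_mem hβ).comp (f := fun x : List (K × LevelCode) × LevelCode => (x.2, x.1))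
    (by fun_prop)).of_eq fun x z => ?_
  simp only [Set.mem_ofPred_eq, stepSup_le_iff, Set.mem_univ, and_true, Set.mem_compl_iff]
  grind

theorem REOpenFamily.lt_stepSup [Primcodable K] {β : K → Set Z} :
    REOpenFamily β fun x : List (K × LevelCode) × LevelCode => {z | x.2.val < stepSup β x.1 z} := by
  have h1 : REOpenFamily β fun x : (List (K × LevelCode) × LevelCode) × K × LevelCode =>
      {z | (x.2 ∈ x.1.1 ∧ x.1.2.val < x.2.2.val) ∧ z ∈ β x.2.1} := by
    refine (REOpenFamily.basis.comp (by fun_prop)).guard (REPred.and ?_ ?_)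
    · exact (primrecPred_mem (by fun_prop) (by fun_prop)).to_re
    · simp only [LevelCode.val_lt_val]
      exact (primrecPred_lt (by fun_prop) (by fun_prop)).to_re
  refine h1.iUnion.of_eq fun x z => ?_
  simp only [Set.mem_ofPred_eq, lt_stepSup_iff]
  grind

end Steps

/-! ### Upper bounds for integrals of step functions -/

section Layers

theorem le_sum_ite_natCast_lt {y : ℝ≥0∞} {K : ℕ} (h : y ≤ K) :
    y ≤ ∑ k ∈ Finset.range K, if (k : ℝ≥0∞) < y then 1 else 0 := by
  induction K with
  | zero => simpa using h
  | succ K ih =>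
    rw [Finset.sum_range_succ]
    rcases le_or_gt y K with hK | hK
    · exact (ih hK).trans le_self_add
    · rw [if_pos hK, Finset.sum_congr rfl fun k hk => if_pos (lt_of_le_of_lt ?_ hK)]
      · simpa using h
      · exact_mod_cast (Finset.mem_range.1 hk).le

theorem sum_ite_natCast_lt_le (y : ℝ≥0∞) (K : ℕ) :
    ∑ k ∈ Finset.range K, (if (k : ℝ≥0∞) < y then 1 else 0) ≤ y + 1 := by
  induction K with
  | zero => simp
  | succ K ih =>
    rcases le_or_gt y K with hK | hK
    · rw [Finset.sum_range_succ, if_neg hK.not_gt, add_zero]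
      exact ih
    · calc _ ≤ ∑ k ∈ Finset.range (K + 1), (1 : ℝ≥0∞) :=
            Finset.sum_le_sum fun k _ => by split_ifs <;> simp
        _ = K + 1 := by simp
        _ ≤ y + 1 := by gcongr

variable {X : Type*} [MeasurableSpace X] {μ : Measure X} {f : X → ℝ≥0∞}

/-- The sum of the measures of the layers of height `1 / (n + 1)`, as the integral of the number of
layers below the graph. -/
theorem sum_measure_layers (hf : Measurable f) (n K : ℕ) :
    ∑ k ∈ Finset.range K, μ {x | LevelCode.val (k, n) < f x} =
      ∫⁻ x, ∑ k ∈ Finset.range K, (if (k : ℝ≥0∞) < f x * (n + 1) then 1 else 0) ∂μ := by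
  have h : ∀ k : ℕ, MeasurableSet {x | (k : ℝ≥0∞) < f x * (n + 1)} := fun k =>
    measurableSet_lt measurable_const (hf.mul_const _)
  rw [lintegral_finsetSum _ fun k _ => Measurable.ite (h k) measurable_const measurable_const]
  refine Finset.sum_congr rfl fun k _ => ?_
  have e : {x | LevelCode.val (k, n) < f x} = {x | (k : ℝ≥0∞) < f x * (n + 1)} := by
    ext x
    exact LevelCode.val_lt_iff
  rw [e, ← lintegral_indicator_one (h k)]
  refine lintegral_congr fun x => ?_
  simp [Set.indicator_apply]

variable [IsProbabilityMeasure μ]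

/-- An upper bound for an integral, from upper bounds for the measures of the layers of height
`1 / (n + 1)`. -/
theorem lintegral_le_of_layers (hf : Measurable f) {n d K : ℕ} {c : ℕ → ℕ}
    (hK : ∀ x, f x ≤ LevelCode.val (K, n))
    (hc : ∀ k < K, μ.real {x | LevelCode.val (k, n) < f x} < (c k : ℝ) / (d + 1)) :
    ∫⁻ x, f x ∂μ ≤ LevelCode.val (∑ k ∈ Finset.range K, c k, n * d + n + d) := by
  have hN : ((n : ℝ≥0∞) + 1) ≠ 0 := by simp
  have hN' : ((n : ℝ≥0∞) + 1) ≠ ∞ := by simp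
  have hD : ((d : ℝ≥0∞) + 1) ≠ 0 := by simp
  have hD' : ((d : ℝ≥0∞) + 1) ≠ ∞ := by simp
  have h1 : (∫⁻ x, f x ∂μ) * (n + 1) ≤ (∑ k ∈ Finset.range K, (c k : ℝ≥0∞)) / (d + 1) := by
    rw [← lintegral_mul_const _ hf]
    calc _ ≤ ∫⁻ x, ∑ k ∈ Finset.range K, (if (k : ℝ≥0∞) < f x * (n + 1) then 1 else 0) ∂μ := by
          refine lintegral_mono fun x => le_sum_ite_natCast_lt ?_
          rw [← ENNReal.le_div_iff_mul_le (.inl hN) (.inl hN')]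
          exact hK x
      _ = ∑ k ∈ Finset.range K, μ {x | LevelCode.val (k, n) < f x} :=
          (sum_measure_layers hf n K).symm
      _ ≤ ∑ k ∈ Finset.range K, (c k : ℝ≥0∞) / (d + 1) := by
          refine Finset.sum_le_sum fun k hk => ?_
          rw [← ofReal_measureReal]
          refine (ENNReal.ofReal_le_ofReal (hc k (Finset.mem_range.1 hk)).le).trans_eq ?_
          rw [ENNReal.ofReal_div_of_pos (by positivity),
            ENNReal.ofReal_add (by positivity) zero_le_one]
          simp
      _ = _ := by simp only [div_eq_mul_inv, Finset.sum_mul]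
  rw [← ENNReal.le_div_iff_mul_le (.inl hN) (.inl hN')] at h1
  refine h1.trans_eq ?_
  simp only [LevelCode.val, div_eq_mul_inv]
  rw [mul_assoc, ← ENNReal.mul_inv (.inl hD) (.inl hD')]
  push_cast
  congr 2
  ring

/-- The upper bounds of `lintegral_le_of_layers` come arbitrarily close to the integral. -/
theorem exists_layers (hf : Measurable f) {S : ℝ≥0∞} (h : ∫⁻ x, f x ∂μ < S) :
    ∃ n : ℕ, ∀ K : ℕ, ∃ (d : ℕ) (c : ℕ → ℕ),
      (∀ k < K, μ.real {x | LevelCode.val (k, n) < f x} < (c k : ℝ) / (d + 1)) ∧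
        LevelCode.val (∑ k ∈ Finset.range K, c k, n * d + n + d) < S := by
  obtain ⟨r, hr, hrS⟩ := ENNReal.lt_iff_exists_add_pos_lt.1 h
  have hI : ∫⁻ x, f x ∂μ ≠ ∞ := (lt_of_lt_of_le h le_top).ne
  obtain ⟨n, hn⟩ := exists_nat_gt (2 / (r : ℝ))
  have hr' : (0 : ℝ) < r := hr
  have hn' : 2 / ((n : ℝ) + 1) ≤ r := by
    rw [div_lt_iff₀ hr'] at hn
    rw [div_le_iff₀ (by positivity)]
    nlinarith
  refine ⟨n, fun K => ?_⟩
  set I := (∫⁻ x, f x ∂μ).toReal with hIdef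
  let M : ℕ → ℝ := fun k => μ.real {x | LevelCode.val (k, n) < f x}
  -- with denominator `K + 1`, the total loss by rounding up the `K` measures is below `1`
  refine ⟨K, fun k => ⌊M k * (K + 1)⌋₊ + 1, fun k _ => ?_, lt_of_le_of_lt ?_ hrS⟩
  · rw [lt_div_iff₀ (by positivity)]
    push_cast
    exact Nat.lt_floor_add_one _
  · have hM : ∑ k ∈ Finset.range K, M k ≤ I * (n + 1) + 1 := by
      have h1 : ∑ k ∈ Finset.range K, μ {x | LevelCode.val (k, n) < f x} ≤
          (∫⁻ x, f x ∂μ) * (n + 1) + 1 := by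
        rw [sum_measure_layers hf, ← lintegral_mul_const _ hf]
        refine (lintegral_mono fun x => sum_ite_natCast_lt_le _ K).trans_eq ?_
        rw [lintegral_add_right _ measurable_const]
        simp
      have h2 := ENNReal.toReal_mono (by finiteness) h1
      rw [ENNReal.toReal_sum fun _ _ => measure_ne_top _ _,
        ENNReal.toReal_add (by finiteness) (by simp), ENNReal.toReal_mul] at h2
      rw [ENNReal.toReal_add (by simp) (by simp)] at h2
      simp only [ENNReal.toReal_natCast, ENNReal.toReal_one] at h2
      exact h2
    have hc : ((∑ k ∈ Finset.range K, (⌊M k * (K + 1)⌋₊ + 1) : ℕ) : ℝ) ≤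
        (K + 1) * (I * (n + 1) + 1) + K := by
      push_cast
      rw [Finset.sum_add_distrib]
      have h3 : ∑ k ∈ Finset.range K, ((⌊M k * (K + 1)⌋₊ : ℕ) : ℝ) ≤
          (K + 1) * ∑ k ∈ Finset.range K, M k := by
        rw [Finset.mul_sum]
        refine Finset.sum_le_sum fun k _ => ?_
        rw [mul_comm]
        exact Nat.floor_le (mul_nonneg (by positivity) measureReal_nonneg)
      have h4 : (K + 1 : ℝ) * ∑ k ∈ Finset.range K, M k ≤ (K + 1) * (I * (n + 1) + 1) := by
        gcongr
      simpa using h3.trans h4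
    set T := ∑ k ∈ Finset.range K, (⌊M k * (K + 1)⌋₊ + 1)
    have hT : (T : ℝ) / (((n * K + n + K : ℕ) : ℝ) + 1) ≤ I + r := by
      have e : (((n * K + n + K : ℕ) : ℝ) + 1) = (n + 1) * (K + 1) := by push_cast; ring
      rw [e, div_le_iff₀ (by positivity)]
      have h5 : 2 ≤ (r : ℝ) * (n + 1) := by
        rwa [div_le_iff₀ (by positivity)] at hn'
      have h6 : 2 * ((K : ℝ) + 1) ≤ r * (n + 1) * (K + 1) := by gcongr
      nlinarith
    have hI' : ∫⁻ x, f x ∂μ = ENNReal.ofReal I := (ENNReal.ofReal_toReal hI).symm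
    rw [hI', ← ENNReal.ofReal_coe_nnreal, ← ENNReal.ofReal_add (by positivity) hr'.le]
    refine le_of_eq_of_le ?_ (ENNReal.ofReal_le_ofReal hT)
    rw [ENNReal.ofReal_div_of_pos (by positivity),
      ENNReal.ofReal_add (by positivity) zero_le_one]
    simp only [ENNReal.ofReal_natCast, ENNReal.ofReal_one, LevelCode.val]

end Layers

section

variable {X P K : Type*} [MeasurableSpace X] {C : K → Set (X × P)}

theorem measurable_stepSup_section [Countable K]
    (hC : ∀ i p, MeasurableSet {x | (x, p) ∈ C i}) (L : List (K × LevelCode)) (p : P) :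
    Measurable fun x => stepSup C L (x, p) := by
  classical
  refine Measurable.iSup fun y => Measurable.iSup fun _ => ?_
  have e : (fun x => ⨆ _ : (x, p) ∈ C y.1, y.2.val) =
      fun x => if x ∈ {x | (x, p) ∈ C y.1} then y.2.val else 0 := by
    ext x
    by_cases hx : (x, p) ∈ C y.1 <;> simp [hx]
  rw [e]
  exact Measurable.ite (hC _ _) measurable_const measurable_const

theorem ratCode_lt_measureReal_le_iff {μ : Measure X} [IsProbabilityMeasure μ] {f : X → ℝ≥0∞}
    (hf : Measurable f) (t : ℝ≥0∞) (c d : ℕ) :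
    ((RatCode.val (d + 1, c, d) : ℚ) : ℝ) < μ.real {x | f x ≤ t} ↔
      μ.real {x | t < f x} < (c : ℝ) / (d + 1) := by
  have h1 : {x | f x ≤ t} = {x | t < f x}ᶜ := by ext x; simp
  have h2 : ((RatCode.val (d + 1, c, d) : ℚ) : ℝ) = 1 - (c : ℝ) / (d + 1) := by
    simp only [RatCode.val]
    push_cast
    field_simp
  rw [h1, probReal_compl_eq_one_sub (measurableSet_lt measurable_const hf), h2]
  constructor <;> intro h <;> linarith

theorem exists_le_mul_of_list (L : List (K × LevelCode)) (n : ℕ) :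
    ∃ k : ℕ, ∀ x ∈ L, x.2.1 * (n + 1) ≤ k * (x.2.2 + 1) := by
  induction L with
  | nil => simp
  | cons y L ih =>
    obtain ⟨k, hk⟩ := ih
    refine ⟨max k (y.2.1 * (n + 1)), List.forall_mem_cons.2 ⟨?_, fun x hx => ?_⟩⟩
    · exact (le_max_right _ _).trans (Nat.le_mul_of_pos_right _ (Nat.succ_pos _))
    · exact (hk x hx).trans (Nat.mul_le_mul_right _ (le_max_left _ _))

/-- The certificates `(n, d, W)` for an integral below `S`: the values are at most `K / (n + 1)`,
where `K` is the length of `W`, and for each `j < K` the set of the values above `j / (n + 1)` has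
measure below `W j / (d + 1)`. The latter is a lower bound for the measure of the complementary
set. -/
theorem lintegral_stepSup_lt_iff [Countable K] {m : P → ProbabilityMeasure X}
    (hC : ∀ i p, MeasurableSet {x | (x, p) ∈ C i}) (L : List (K × LevelCode)) (p : P) (S : ℝ≥0∞) :
    ∫⁻ x, stepSup C L (x, p) ∂(m p : Measure X) < S ↔
      ∃ k : ℕ × ℕ × List ℕ,
        (∀ x ∈ L, x.2.1 * (k.1 + 1) ≤ k.2.2.length * (x.2.2 + 1)) ∧
        (∀ j ∈ List.range k.2.2.length,
          ((RatCode.val (k.2.1 + 1, k.2.2.getD j 0, k.2.1) : ℚ) : ℝ) <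
            (m p : Measure X).real {x | stepSup C L (x, p) ≤ LevelCode.val (j, k.1)}) ∧
        LevelCode.val (((List.range k.2.2.length).map fun j => k.2.2.getD j 0).sum,
          k.1 * k.2.1 + k.1 + k.2.1) < S := by
  have hf := measurable_stepSup_section hC L p
  simp only [ratCode_lt_measureReal_le_iff hf, List.mem_range]
  have hsum : ∀ (l : ℕ) (c : ℕ → ℕ), ((List.range l).map c).sum = ∑ j ∈ Finset.range l, c j :=
    fun l c => rfl
  simp only [hsum]
  constructor
  · intro h
    obtain ⟨n, hn⟩ := exists_layers hf h
    obtain ⟨k, hk⟩ := exists_le_mul_of_list L n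
    obtain ⟨d, c, h1, h2⟩ := hn k
    have hget : ∀ j < k, ((List.range k).map c).getD j 0 = c j := fun j hj => by
      simp [List.getD, hj]
    refine ⟨(n, d, (List.range k).map c), by simpa using hk, ?_, ?_⟩
    · simp only [List.length_map, List.length_range]
      intro j hj
      rw [hget j hj]
      exact h1 j hj
    · simp only [List.length_map, List.length_range]
      rwa [Finset.sum_congr rfl fun j hj => hget j (Finset.mem_range.1 hj)]
  · rintro ⟨⟨n, d, W⟩, h1, h2, h3⟩
    refine (lintegral_le_of_layers hf (fun x => ?_) h2).trans_lt h3
    exact stepSup_le_iff.2 fun y hy _ => LevelCode.val_le_val.2 (h1 y hy)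

end

section Acceptance

variable {X P J K : Type*} [MetricSpace X] [ComputableMetricSpace X] [MeasurableSpace X]
  [BorelSpace X] [Primcodable J] [Primcodable K] {π : J → Set P} {m : P → ProbabilityMeasure X}
  {C : K → Set (X × P)}

/-- The set of parameters at which the integral of a step function over closed sets is below a
lower semicomputable bound is recursively enumerable open, uniformly in the step function. -/
theorem REOpenFamily.lintegral_stepSup_lt (hm : IsEffectiveParameter π m)
    (hC : REOpenFamily (prodBasis (ballBasis X) π) fun i => (C i)ᶜ) {s : P → ℝ≥0∞}
    (hs : LowerSemicomputable π s) :
    REOpenFamily π fun L : List (K × LevelCode) =>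
      {p | ∫⁻ x, stepSup C L (x, p) ∂(m p : Measure X) < s p} := by
  have hC' : ∀ i p, MeasurableSet {x | (x, p) ∈ C i} := fun i p =>
    MeasurableSet.of_compl (hC.isOpen_section i p).measurableSet
  have hget : Primrec fun x : (List (K × LevelCode) × ℕ × ℕ × List ℕ) × ℕ =>
      x.1.2.2.2.getD x.2 0 :=
    (Primrec.list_getD 0).comp (by fun_prop) (by fun_prop)
  have hlen : Primrec fun x : List (K × LevelCode) × ℕ × ℕ × List ℕ => x.2.2.2.length :=
    Primrec.list_length.comp (by fun_prop)
  have h1 : REPred fun x : List (K × LevelCode) × ℕ × ℕ × List ℕ =>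
      ∀ y ∈ x.1, y.2.1 * (x.2.1 + 1) ≤ x.2.2.2.length * (y.2.2 + 1) := by
    have h : REPred fun x : (List (K × LevelCode) × ℕ × ℕ × List ℕ) × K × LevelCode =>
        x.2.2.1 * (x.1.2.1 + 1) ≤ x.1.2.2.2.length * (x.2.2.2 + 1) :=
      (primrecPred_le (by fun_prop) (primrec_mul (hlen.comp Primrec.fst) (by fun_prop))).to_re
    exact h.forall_mem.comp (f := fun x : List (K × LevelCode) × ℕ × ℕ × List ℕ => (x, x.1))
      (by fun_prop)
  have h2 := (((REOpenFamily.stepSup_le (hasEffectiveInter_ballBasis X |>.prod hm.inter)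
    hC).lt_measureReal_section hm).comp
      (f := fun x : (List (K × LevelCode) × ℕ × ℕ × List ℕ) × ℕ =>
        ((x.1.1, (x.2, x.1.2.1)), (x.1.2.2.1 + 1, x.1.2.2.2.getD x.2 0, x.1.2.2.1)))
      (by fun_prop)).forall_mem hm.inter
  have h3 := h2.comp (f := fun x : List (K × LevelCode) × ℕ × ℕ × List ℕ =>
    (x, List.range x.2.2.2.length)) (by fun_prop)
  have h4 := (lowerSemicomputable_iff.1 hs).comp
    (f := fun x : List (K × LevelCode) × ℕ × ℕ × List ℕ =>
      (((List.range x.2.2.2.length).map fun j => x.2.2.2.getD j 0).sum,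
        x.2.1 * x.2.2.1 + x.2.1 + x.2.2.1)) (by fun_prop)
  refine ((h3.inter hm.inter h4).guard h1).iUnion.of_eq fun L p => ?_
  simp only [Set.mem_ofPred_eq]
  exact (lintegral_stepSup_lt_iff hC' L p (s p)).symm

end Acceptance

/-! ### Trimming -/

section Trimming

variable {X P J : Type*} [MetricSpace X] [ComputableMetricSpace X] [MeasurableSpace X]
  [BorelSpace X] [Primcodable J] {π : J → Set P} {m : P → ProbabilityMeasure X}
  {s : P → ℝ≥0∞}

/-- A uniformly lower semicomputable sequence is approximated from below by an effective increasing
sequence of step functions over basis elements, and the larger step functions over the separating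
closed sets are below it too. -/
theorem UniformlyLowerSemicomputable.exists_steps {Z I : Type*} [Primcodable I] {β C : I → Set Z}
    {sh : I × ℕ → I} (h : EffectivelyRegular β C sh) {φ : ℕ → Z → ℝ≥0∞}
    (hφ : UniformlyLowerSemicomputable β φ) :
    ∃ L : ℕ → ℕ → List (I × LevelCode), Primrec (fun x : ℕ × ℕ => L x.1 x.2) ∧
      (∀ e m n, m ≤ n → L e m ⊆ L e n) ∧ (∀ e n z, stepSup C (L e n) z ≤ φ e z) ∧
      ∀ e z, φ e z = ⨆ n, stepSup β (L e n) z := by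
  obtain ⟨A, hA, hAφ⟩ := uniformlyLowerSemicomputable_iff.1 hφ
  simp only [Set.mem_ofPred_eq] at hAφ
  have hp : REPred fun x : ℕ × I × LevelCode =>
      ∃ y : I × ℕ, sh y = x.2.1 ∧ A ((x.1, x.2.2), y.1) := by
    have := h.primrec
    refine REPred.exists (p := fun v : (ℕ × I × LevelCode) × I × ℕ =>
      sh v.2 = v.1.2.1 ∧ A ((v.1.1, v.1.2.2), v.2.1)) (REPred.and ?_ ?_)
    · exact (primrecPred_eq (by fun_prop) (by fun_prop)).to_re
    · exact hA.comp (f := fun v : (ℕ × I × LevelCode) × I × ℕ => ((v.1.1, v.1.2.2), v.2.1))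
        (by fun_prop)
  obtain ⟨L, hL, hmono, hLA⟩ := hp.exists_stages
  have hle : ∀ e n z, stepSup C (L e n) z ≤ φ e z := by
    refine fun e n z => stepSup_le_iff.2 fun x hx hz => ?_
    obtain ⟨⟨i, k⟩, hi, hiA⟩ := (hLA e x).2 ⟨n, hx⟩
    refine ((hAφ (e, x.2) z).2 ⟨i, hiA, h.closed_subset i k ?_⟩).le
    rwa [hi]
  refine ⟨L, hL, hmono, hle, fun e z => le_antisymm (le_of_forall_lt fun t ht => ?_)
    (iSup_le fun n => (stepSup_mono h.subset_closed (List.Subset.refl _) z).trans (hle e n z))⟩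
  obtain ⟨q, htq, hq⟩ := LevelCode.exists_btwn ht
  obtain ⟨i, hi, hz⟩ := (hAφ (e, q) z).1 hq
  obtain ⟨k, hk⟩ := (h.eventually_mem i z hz).exists
  obtain ⟨n, hn⟩ := (hLA e (sh (i, k), q)).1 ⟨(i, k), rfl, hi⟩
  exact lt_iSup_iff.2 ⟨n, lt_stepSup_iff.2 ⟨_, hn, hk, htq⟩⟩

theorem LowerSemicomputable.measurable_section {f : X × P → ℝ≥0∞}
    (hf : LowerSemicomputable (prodBasis (ballBasis X) π) f) (p : P) :
    Measurable fun x => f (x, p) := by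
  refine LowerSemicontinuous.measurable fun x t ht => ?_
  obtain ⟨q, htq, hq⟩ := LevelCode.exists_btwn ht
  have h1 := (lowerSemicomputable_iff.1 hf).isOpen_section q p
  filter_upwards [h1.mem_nhds hq] with y hy using htq.trans hy

/-- Trimming: every uniformly lower semicomputable sequence can be cut down effectively to a
sequence of functions whose integrals are below `s`. The stages over the closed sets are bounded,
so nothing is cut off at a parameter with `s p = ∞` either. -/
theorem UniformlyLowerSemicomputable.exists_trim (hm : IsEffectiveParameter π m)
    {φ : ℕ → X × P → ℝ≥0∞}
    (hφ : UniformlyLowerSemicomputable (prodBasis (ballBasis X) π) φ)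
    (hs : LowerSemicomputable π s) :
    ∃ ψ : ℕ → X × P → ℝ≥0∞, UniformlyLowerSemicomputable (prodBasis (ballBasis X) π) ψ ∧
      (∀ e p, ∫⁻ x, ψ e (x, p) ∂(m p : Measure X) ≤ s p) ∧
      ∀ e p, (∫⁻ x, φ e (x, p) ∂(m p : Measure X) < s p ∨ s p = ∞) →
        ∀ x, ψ e (x, p) = φ e (x, p) := by
  obtain ⟨D, sh, hreg⟩ := hm.regular
  have hinter := (hasEffectiveInter_ballBasis X).prod hm.inter
  have hR := (effectivelyRegular_ballBasis X).prod (hasEffectiveInter_ballBasis X) hm.inter hreg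
  set C := prodBasis (closedBalls X) D
  obtain ⟨L, hL, hmono, hle, hsup⟩ := hφ.exists_steps hR
  let acc : ℕ → ℕ → Set P := fun e n =>
    {p | ∫⁻ x, stepSup C (L e n) (x, p) ∂(m p : Measure X) < s p}
  refine ⟨fun e z => ⨆ (n : ℕ) (_ : z.2 ∈ acc e n), stepSup (prodBasis (ballBasis X) π) (L e n) z,
    ?_, fun e p => ?_, fun e p h x => ?_⟩
  · have hL' : Primrec fun x : (ℕ × LevelCode) × ℕ => L x.1.1 x.2 :=
      hL.comp (f := L.uncurry) (g := fun x : (ℕ × LevelCode) × ℕ => (x.1.1, x.2)) (by fun_prop)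
    have h1 := ((REOpenFamily.lintegral_stepSup_lt hm hR.compl hs).comp hL').preimage_snd
      (hasEffectiveInter_ballBasis X)
    have h2 := (REOpenFamily.lt_stepSup (β := prodBasis (ballBasis X) π)).comp
      (f := fun x : (ℕ × LevelCode) × ℕ => (L x.1.1 x.2, x.1.2)) (by fun_prop)
    refine uniformlyLowerSemicomputable_iff.2 ((h1.inter hinter h2).iUnion.of_eq fun x z => ?_)
    simp only [Set.mem_ofPred_eq, lt_iSup_iff, exists_prop, acc]
  · have hopen : ∀ i p, MeasurableSet {x | (x, p) ∈ prodBasis (ballBasis X) π i} := fun i p =>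
      (REOpenFamily.isOpen_section (U := prodBasis (ballBasis X) π)
        REOpenFamily.basis i p).measurableSet
    have hmeas : ∀ n, Measurable fun x => stepSup (prodBasis (ballBasis X) π) (L e n) (x, p) :=
      fun n => measurable_stepSup_section hopen (L e n) p
    simp only [iSup_subtype']
    let g : {n // p ∈ acc e n} → X → ℝ≥0∞ := fun n x =>
      stepSup (prodBasis (ballBasis X) π) (L e n) (x, p)
    have hg : ∀ n, AEMeasurable (g n) (m p : Measure X) := fun n => (hmeas n).aemeasurable
    have hdir : Directed (· ≤ ·) g := directed_of_isDirected_le fun n k hnk x =>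
      stepSup_mono (fun _ => subset_rfl) (hmono e _ _ hnk) _
    refine (lintegral_iSup_directed hg hdir).trans_le (iSup_le fun n => ?_)
    refine (lintegral_mono fun x => ?_).trans n.2.le
    exact stepSup_mono hR.subset_closed (List.Subset.refl _) _
  · have hacc : ∀ n, p ∈ acc e n := by
      intro n
      rcases h with h | h
      · exact (lintegral_mono fun x => hle e n (x, p)).trans_lt h
      · obtain ⟨k, hk⟩ := exists_le_mul_of_list (L e n) 0
        have hb : ∀ x, stepSup C (L e n) (x, p) ≤ LevelCode.val (k, 0) := fun x =>
          stepSup_le_iff.2 fun y hy _ => LevelCode.val_le_val.2 (hk y hy)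
        simp only [acc, Set.mem_ofPred_eq, h]
        refine (lintegral_mono hb).trans_lt ?_
        simpa using LevelCode.val_lt_top _
    simp only [hacc, iSup_true]
    exact (hsup e (x, p)).symm

variable (s) in
/-- Among the lower semicomputable functions with integrals below `s` there is one that dominates
all the others, up to constant factors, wherever `s` is positive. -/
theorem exists_optimal (hm : IsEffectiveParameter π m) (hs : LowerSemicomputable π s) :
    ∃ ψ : X × P → ℝ≥0∞, (LowerSemicomputable (prodBasis (ballBasis X) π) ψ ∧
        ∀ p, ∫⁻ x, ψ (x, p) ∂(m p : Measure X) ≤ s p) ∧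
      ∀ φ : X × P → ℝ≥0∞, LowerSemicomputable (prodBasis (ballBasis X) π) φ →
        (∀ p, ∫⁻ x, φ (x, p) ∂(m p : Measure X) ≤ s p) →
        ∃ c : ℝ≥0, 0 < c ∧ ∀ x p, 0 < s p → φ (x, p) ≤ 2 * c * ψ (x, p) := by
  have hG := isGoedelEnumeration_universalSeq (prodBasis (ballBasis X) π)
  obtain ⟨ψ, hψ, hint, heq⟩ := hG.effective.exists_trim hm hs
  have hw := hψ.div_two_pow (k := fun e => e + 1) (by fun_prop)
  refine ⟨fun z => ⨆ e, ψ e z / 2 ^ (e + 1), ⟨hw.iSup, fun p => ?_⟩, fun φ hφ hφs => ?_⟩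
  · have hmeas : ∀ e, Measurable fun x => ψ e (x, p) := fun e =>
      (hψ.lowerSemicomputable e).measurable_section p
    calc ∫⁻ x, ⨆ e, ψ e (x, p) / 2 ^ (e + 1) ∂(m p : Measure X)
        ≤ ∫⁻ x, ∑' e, ψ e (x, p) / 2 ^ (e + 1) ∂(m p : Measure X) :=
          lintegral_mono fun x => iSup_le fun e => ENNReal.le_tsum e
      _ = ∑' e, (∫⁻ x, ψ e (x, p) ∂(m p : Measure X)) * (2 ^ (e + 1))⁻¹ := by
          simp only [div_eq_mul_inv]
          rw [lintegral_tsum fun e => ((hmeas e).mul_const _).aemeasurable]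
          exact tsum_congr fun e => lintegral_mul_const _ (hmeas e)
      _ ≤ ∑' e : ℕ, s p * (2 ^ (e + 1))⁻¹ := ENNReal.tsum_le_tsum fun e =>
          mul_le_mul_left (hint e p) _
      _ = s p := by
          rw [ENNReal.tsum_mul_left]
          simp only [ENNReal.inv_pow]
          rw [ENNReal.tsum_geometric_add_one, ENNReal.one_sub_inv_two, inv_inv,
            ENNReal.inv_mul_cancel two_ne_zero ENNReal.ofNat_ne_top, mul_one]
  · -- halving makes the integral strictly smaller than a positive finite bound
    have hhalf : LowerSemicomputable (prodBasis (ballBasis X) π) fun z => φ z / 2 := by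
      simpa using (hφ.uniformly_const.div_two_pow (k := fun _ => 1)
        (by fun_prop)).lowerSemicomputable 0
    obtain ⟨e, he⟩ := hG.exhaustive _ hhalf
    refine ⟨2 ^ (e + 1), by positivity, fun x p hsp => ?_⟩
    have h1 : ψ e (x, p) = φ (x, p) / 2 := by
      rw [heq e p ?_ x, he]
      rw [or_iff_not_imp_right]
      intro htop
      rw [he]
      simp only [div_eq_mul_inv]
      rw [lintegral_mul_const' _ _ (by simp)]
      refine (mul_le_mul_left (hφs p) _).trans_lt ?_
      rw [← div_eq_mul_inv]
      exact ENNReal.half_lt_self hsp.ne' htop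
    have h2 : ψ e (x, p) / 2 ^ (e + 1) ≤ ⨆ e, ψ e (x, p) / 2 ^ (e + 1) :=
      le_iSup (fun e => ψ e (x, p) / 2 ^ (e + 1)) e
    calc φ (x, p) = 2 * (2 ^ (e + 1) * (ψ e (x, p) / 2 ^ (e + 1))) := by
          rw [ENNReal.mul_div_cancel (by simp) (by simp), h1,
            ENNReal.mul_div_cancel (by simp) (by simp)]
      _ ≤ 2 * (2 ^ (e + 1) * ⨆ e, ψ e (x, p) / 2 ^ (e + 1)) := by gcongr
      _ = _ := by push_cast; rw [mul_assoc]

end Trimming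

/-! ### The spaces of parameters -/

section Parameters

variable (X Y : Type*) [MetricSpace X] [ComputableMetricSpace X] [MeasurableSpace X]
  [MetricSpace Y] [ComputableMetricSpace Y]

theorem isEffectiveParameter_measBasis :
    IsEffectiveParameter (measBasis X) fun μ : ProbabilityMeasure X => μ where
  inter := hasEffectiveInter_measBasis X
  regular := ⟨_, _, effectivelyRegular_measBasis X⟩
  integral_hatMax := reOpenFamily_integral_hatMax X

theorem isEffectiveParameter_paramMeasBasis :
    IsEffectiveParameter (paramMeasBasis X Y) fun p : Y × ProbabilityMeasure X => p.2 where
  inter := (hasEffectiveInter_ballBasis Y).prod (hasEffectiveInter_measBasis X)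
  regular := ⟨_, _, (effectivelyRegular_ballBasis Y).prod (hasEffectiveInter_ballBasis Y)
    (hasEffectiveInter_measBasis X) (effectivelyRegular_measBasis X)⟩
  integral_hatMax := (reOpenFamily_integral_hatMax X).preimage_snd (hasEffectiveInter_ballBasis Y)

end Parameters

theorem lowerSemicomputable_one {I Z : Type*} [Primcodable I] {β : I → Set Z}
    (hβ : HasEffectiveInter β) : LowerSemicomputable β fun _ => 1 := by
  refine lowerSemicomputable_iff.2 (((REOpenFamily.univ hβ).guard
    (p := fun q : LevelCode => q.1 < q.2 + 1) (primrecPred_lt (by fun_prop)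
      (by fun_prop)).to_re).of_eq fun q z => ?_)
  have h : q.val < 1 ↔ q.1 < q.2 + 1 := by
    rw [LevelCode.val_lt_iff, one_mul]
    exact_mod_cast Iff.rfl
  simp [h]

end AlgRandom

end

theorem mainTheorem6 {X Y : Type*}
    [MetricSpace X] [AlgRandom.ComputableMetricSpace X] [MeasurableSpace X] [BorelSpace X]
    [MetricSpace Y] [AlgRandom.ComputableMetricSpace Y] :
    -- acceptable enumerations of all lower semicomputable functions exist
    (∃ φ : ℕ → X × Y × ProbabilityMeasure X → ℝ≥0∞,
      AlgRandom.IsGoedelEnumeration (AlgRandom.pointParamMeasBasis X Y) φ) ∧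
    -- trimming
    (∀ φ : ℕ → X × Y × ProbabilityMeasure X → ℝ≥0∞,
      AlgRandom.IsGoedelEnumeration (AlgRandom.pointParamMeasBasis X Y) φ →
      ∀ s : Y × ProbabilityMeasure X → ℝ≥0∞,
        AlgRandom.LowerSemicomputable (AlgRandom.paramMeasBasis X Y) s →
        ∃ r : ℕ → ℕ, Computable r ∧
          (∀ (e : ℕ) (y : Y) (μ : ProbabilityMeasure X),
            ∫⁻ x, φ (r e) (x, y, μ) ∂(μ : Measure X) ≤ s (y, μ)) ∧
          (∀ (e : ℕ) (y : Y) (μ : ProbabilityMeasure X),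
            ∫⁻ x, φ e (x, y, μ) ∂(μ : Measure X) < s (y, μ) →
            ∀ x : X, φ (r e) (x, y, μ) = φ e (x, y, μ))) ∧
    -- an optimal function below the bound
    (∀ s : Y × ProbabilityMeasure X → ℝ≥0∞,
      AlgRandom.LowerSemicomputable (AlgRandom.paramMeasBasis X Y) s →
      ∃ ψ ∈ AlgRandom.boundedFunctions s, ∀ φ ∈ AlgRandom.boundedFunctions s,
        ∃ c : ℝ≥0, ∀ (x : X) (y : Y) (μ : ProbabilityMeasure X),
          0 < s (y, μ) → φ (x, y, μ) ≤ 2 * c * ψ (x, y, μ)) ∧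
    -- a universal uniform test
    (∃ u : X × ProbabilityMeasure X → ℝ≥0∞, AlgRandom.IsUniversalUniformTest u) := by
  refine ⟨⟨_, AlgRandom.isGoedelEnumeration_universalSeq _⟩, fun φ hφ s hs => ?_, fun s hs => ?_, ?_⟩
  · obtain ⟨ψ, hψ, hint, heq⟩ :=
      hφ.effective.exists_trim (AlgRandom.isEffectiveParameter_paramMeasBasis X Y) hs
    obtain ⟨r, hr, hrψ⟩ := hφ.translation ψ hψ
    refine ⟨r, hr, fun e y μ => ?_, fun e y μ h x => ?_⟩
    · rw [hrψ]
      exact hint e (y, μ)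
    · rw [hrψ]
      exact heq e (y, μ) (.inl h) x
  · obtain ⟨ψ, ⟨hψ, hint⟩, hopt⟩ :=
      AlgRandom.exists_optimal s (AlgRandom.isEffectiveParameter_paramMeasBasis X Y) hs
    refine ⟨ψ, ⟨hψ, fun y μ => hint (y, μ)⟩, fun φ hφ => ?_⟩
    obtain ⟨c, -, hc⟩ := hopt φ hφ.1 fun p => hφ.2 p.1 p.2
    exact ⟨c, fun x y μ => hc x (y, μ)⟩
  · obtain ⟨u, hu, hopt⟩ := AlgRandom.exists_optimal (fun _ => 1)
      (AlgRandom.isEffectiveParameter_measBasis X)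
      (AlgRandom.lowerSemicomputable_one (AlgRandom.hasEffectiveInter_measBasis X))
    refine ⟨u, hu, fun t ht => ?_⟩
    obtain ⟨c, hc0, hc⟩ := hopt t ht.1 ht.2
    refine ⟨2 * c, by positivity, fun x μ => ?_⟩
    simpa using hc x μ one_pos
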